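/- Theorem (low-rank tomography). Let $n\ge 0$ be the number of qubits and $d=2^n$. For a label $a\in\{0,1,2,3\}^n$ let $w(a)=\bigotimes_{k=1}^n\sigma_{a_k}$ be the corresponding $n$-qubit Pauli matrix, where $\sigma_0=\mathbb 1$ and $\sigma_1,\sigma_2,\sigma_3$ are the Pauli matrices $\sigma^x,\sigma^y,\sigma^z$; there are $d^2$ of them. Let $\|\cdot\|_{\mathrm{tr}}$ denote the trace norm, i.e. the sum of the singular values. There are absolute constants $C,\alpha>0$ such that the following holds for every $n$, every $d\times d$ density matrix $\rho$ (positive semidefinite, $\operatorname{tr}\rho=1$), every real $c>0$ and every natural number $m\ge c\,d\,r\,(\log d)^2$, where $r$ is the rank of $\rho$. Choose labels $A_1,\dots,A_m$ independently and uniformly at random from the $d^2$ labels. Then, with probability at least $1-Ce^{-\alpha c}$, the matrix $\rho$ is the unique solution of the convex program $$\min_\sigma\ \|\sigma\|_{\mathrm{tr}}\quad\text{subject to}\quad \operatorname{tr}\sigma=1,\qquad \operatorname{tr}\big(w(A_i)\sigma\big)=\operatorname{tr}\big(w(A_i)\rho\big)\quad (i=1,\dots,m),$$ where $\sigma$ ranges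 over all complex $d\times d$ matrices. -/

import Mathlib

open MeasureTheory ProbabilityTheory
open scoped ComplexOrder Matrix

namespace PauliTomography

noncomputable section

/-- Labels of the computational basis of `n` qubits; there are `2 ^ n` of them. -/
abbrev Basis (n : ℕ) : Type := Fin n → Fin 2

/-- Operators on the `n`-qubit space, as complex matrices of size `2 ^ n`. -/
abbrev Operator (n : ℕ) : Type := Matrix (Basis n) (Basis n) ℂ

/-- Labels of the `n`-qubit Pauli matrices; there are `4 ^ n = (2 ^ n) ^ 2` of them. -/
abbrev PauliLabel (n : ℕ) : Type := Fin n → Fin 4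

/-- The identity and the three Pauli matrices of one qubit. -/
def pauli1 : Fin 4 → Matrix (Fin 2) (Fin 2) ℂ :=
  ![!![1, 0; 0, 1],
    !![0, 1; 1, 0],
    !![0, -Complex.I; Complex.I, 0],
    !![1, 0; 0, -1]]

/-- The `n`-qubit Pauli matrix `w(a)`: the tensor product over the qubits `k` of the one-qubit
matrices labelled by `a k`, written entrywise in the computational basis. -/
def pauli {n : ℕ} (a : PauliLabel n) : Operator n :=
  Matrix.of fun x y => ∏ k, pauli1 (a k) (x k) (y k)

/-- A density matrix (quantum state): positive semidefinite of trace one. -/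
structure IsDensityMatrix {n : ℕ} (ρ : Operator n) : Prop where
  posSemidef : ρ.PosSemidef
  trace_eq_one : ρ.trace = 1

/-- The trace norm: the sum of the singular values, which are the square roots of the
eigenvalues (with multiplicity) of `σᴴ * σ`. -/
def traceNorm {n : ℕ} (σ : Operator n) : ℝ :=
  ∑ x, Real.sqrt ((Matrix.isHermitian_conjTranspose_mul_self σ).eigenvalues x)

/-- The expectation values `tr (w(A i) ρ)` of the Pauli matrices labelled by `A`. -/
def expectations {n m : ℕ} (A : Fin m → PauliLabel n) (ρ : Operator n) : Fin m → ℂ :=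
  fun i => (pauli (A i) * ρ).trace

/-- The feasible set of the convex program with measured labels `A` and data `b`:
matrices of trace one which reproduce the data. -/
def feasible {n m : ℕ} (A : Fin m → PauliLabel n) (b : Fin m → ℂ) : Set (Operator n) :=
  {σ | σ.trace = 1 ∧ expectations A σ = b}

/-- The set of all solutions of the program: minimize the trace norm over the feasible set. -/
def solutions {n m : ℕ} (A : Fin m → PauliLabel n) (b : Fin m → ℂ) : Set (Operator n) :=
  {σ | σ ∈ feasible A b ∧ ∀ τ ∈ feasible A b, traceNorm σ ≤ traceNorm τ}

/-- The law of `m` independent labels, each uniformly distributed over all `4 ^ n` labels. -/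
def samplingLaw (n m : ℕ) : Measure (Fin m → PauliLabel n) :=
  Measure.pi fun _ => (PMF.uniformOfFintype (PauliLabel n)).toMeasure

end

end PauliTomography

/-!
The trace norm of a matrix of trace one is at least one, with equality exactly for positive
semidefinite matrices. So the theorem says that, with high probability, no other state has the same
data as `ρ` (`solutions_eq_singleton`).

Let `Q` be the projection onto the kernel of `ρ`, and call a matrix `X` tangent if `Q X Q = 0`. The
difference `Δ` of two states with the same data satisfies `Q Δ Q ≥ 0`, has trace zero, and is
orthogonal to all measured Pauli matrices. It is zero if there is a dual certificate, a real
combination `Y` of the measured matrices whose tangent part is nearly the tangent matrix `1 - Q`,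
while `Q Y Q ≤ 1 / 2` (`IsGolfSetup.eq_zero`). How small the error has to be depends on a bound for
the tangent part of `Δ` in terms of `Q Δ Q`; approximate certificates for the tangent parts of all
Pauli matrices give a bound which is polynomial in `d` (`IsGolfSetup.hs_tangentProj_le`).

All certificates come from one random process, a variant of the golfing scheme which uses the labels
one at a time. It keeps a residual `F`, at first the target, and at the label `a` it adds
`γ ⟨w a, F⟩ w a` to the certificate. On average this is `γ / d` times `F`, so that the energy
`‖F‖ ^ 2` decreases, deterministically by at least `γ ⟨w a, F⟩ ^ 2`
(`IsGolfSetup.energy_golfStep_le`) and exponentially fast on average. Two supermartingales turn this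
into tail bounds:
* a power of the energy, whose exponent is so large that Markov's inequality is exponentially good
  (`IsGolfSetup.card_energy_gt_le`);
* `exp (θ ^ 2 γ ‖F‖ ^ 2) * tr (exp (θ Q Y Q))`, where the loss of energy compensates the fluctuation
  of `Y` (`IsGolfSetup.card_certificate_le`). The step uses the Golden–Thompson inequality
  (`trace_exp_add_le`), together with `exp (x - b ^ 2) ≤ 1 + x` for `|x| ≤ b ≤ 1 / 2`.

The gain `γ` is `d log d / m` times a constant, which is chosen such that `m` steps shrink the
energy by the power of `d` that the duality argument asks for; the fluctuations are then small if
`m` is large compared to `d r (log d) ^ 2`.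
-/

namespace PauliTomography

/-! ### The Hilbert–Schmidt inner product -/

section HilbertSchmidt

variable {ι : Type*} [Fintype ι]

/-- The Hilbert–Schmidt inner product `tr (Xᴴ Y)`, as a real inner product: only the real part is
kept. -/
noncomputable def hs (X Y : Matrix ι ι ℂ) : ℝ := (Xᴴ * Y).trace.re

lemma hs_eq_sum (X Y : Matrix ι ι ℂ) :
    hs X Y = ∑ i, ∑ j, ((X i j).re * (Y i j).re + (X i j).im * (Y i j).im) := by
  rw [hs, Matrix.trace, Complex.re_sum, Finset.sum_comm]
  refine Finset.sum_congr rfl fun j _ => ?_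
  simp [Matrix.mul_apply, Complex.mul_re]

lemma hs_comm (X Y : Matrix ι ι ℂ) : hs X Y = hs Y X := by
  simp only [hs_eq_sum, mul_comm]

lemma hs_add_left (X Y Z : Matrix ι ι ℂ) : hs (X + Y) Z = hs X Z + hs Y Z := by
  simp [hs, Matrix.add_mul]

lemma hs_sub_left (X Y Z : Matrix ι ι ℂ) : hs (X - Y) Z = hs X Z - hs Y Z := by
  simp [hs, Matrix.sub_mul]

lemma hs_smul_left (s : ℝ) (X Z : Matrix ι ι ℂ) : hs (s • X) Z = s * hs X Z := by
  simp [hs]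

lemma hs_add_right (X Y Z : Matrix ι ι ℂ) : hs Z (X + Y) = hs Z X + hs Z Y := by
  simp [hs, Matrix.mul_add]

lemma hs_sub_right (X Y Z : Matrix ι ι ℂ) : hs Z (X - Y) = hs Z X - hs Z Y := by
  simp [hs, Matrix.mul_sub]

lemma hs_smul_right (s : ℝ) (X Z : Matrix ι ι ℂ) : hs Z (s • X) = s * hs Z X := by
  simp [hs]

lemma hs_sum_left {L : Type*} (s : Finset L) (f : L → Matrix ι ι ℂ) (Z : Matrix ι ι ℂ) :
    hs (∑ a ∈ s, f a) Z = ∑ a ∈ s, hs (f a) Z := by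
  simp [hs, Matrix.conjTranspose_sum, Finset.sum_mul, Matrix.trace_sum]

lemma hs_self_nonneg (X : Matrix ι ι ℂ) : 0 ≤ hs X X := by
  rw [hs_eq_sum]
  exact Finset.sum_nonneg fun i _ => Finset.sum_nonneg fun j _ =>
    add_nonneg (mul_self_nonneg _) (mul_self_nonneg _)

lemma hs_self_eq_zero {X : Matrix ι ι ℂ} (h : hs X X ≤ 0) : X = 0 := by
  apply Matrix.trace_conjTranspose_mul_self_eq_zero_iff.1
  have h0 := (Matrix.posSemidef_conjTranspose_mul_self X).trace_nonneg
  rw [Complex.le_def] at h0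
  apply Complex.ext
  · exact le_antisymm h h0.1
  · exact h0.2.symm

lemma hs_mul_hs_le (X Y : Matrix ι ι ℂ) : hs X Y ^ 2 ≤ hs X X * hs Y Y := by
  have h := discrim_le_zero (a := hs Y Y) (b := 2 * hs X Y) (c := hs X X) fun s => by
    have := hs_self_nonneg (X + s • Y)
    simp only [hs_add_left, hs_add_right, hs_smul_left, hs_smul_right, hs_comm Y X] at this
    linarith
  rw [discrim] at h
  linarith

lemma hs_conj (X Y : Matrix ι ι ℂ) {Q : Matrix ι ι ℂ} (hQ : Q.IsHermitian) :
    hs (Q * X * Q) Y = hs X (Q * Y * Q) := by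
  simp only [hs, Matrix.conjTranspose_mul, hQ.eq]
  rw [Matrix.trace_mul_comm, ← Matrix.mul_assoc, Matrix.trace_mul_comm]
  simp only [Matrix.mul_assoc]

lemma trace_re_mul_self_le (X : Matrix ι ι ℂ) : (X * X).trace.re ≤ (X * Xᴴ).trace.re := by
  have h := hs_self_nonneg (Xᴴ - X)
  rw [hs_sub_left, hs_sub_right, hs_sub_right] at h
  simp only [hs, Matrix.conjTranspose_conjTranspose] at h
  have h1 : (Xᴴ * Xᴴ).trace.re = (X * X).trace.re := by
    rw [← Matrix.conjTranspose_mul, Matrix.trace_conjTranspose]; simp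
  rw [Matrix.trace_mul_comm Xᴴ X] at h
  linarith

omit [Fintype ι] in
lemma real_smul_isHermitian {X : Matrix ι ι ℂ} (h : X.IsHermitian) (s : ℝ) :
    (s • X).IsHermitian := by
  rw [Matrix.IsHermitian, Matrix.conjTranspose_smul, h.eq, star_trivial]

end HilbertSchmidt

/-! ### The Golden–Thompson inequality -/

section GoldenThompson

variable {ι : Type*} [Fintype ι] [DecidableEq ι]

lemma trace_mul_pow_comm (X Y : Matrix ι ι ℂ) (k : ℕ) :
    ((X * Y) ^ k).trace = ((Y * X) ^ k).trace := by
  cases k with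
  | zero => simp
  | succ k =>
    rw [pow_succ', Matrix.mul_assoc, Matrix.trace_mul_comm, Matrix.mul_assoc, mul_pow_mul,
      ← Matrix.mul_assoc, ← pow_succ']

/-- Weyl's and the Araki–Lieb–Thirring trace inequalities for exponents that are powers of two.
They are proved together: each of the two gives the other one at the next power. -/
lemma trace_pow_two_pow_le (k : ℕ) :
    (∀ X : Matrix ι ι ℂ, (X ^ 2 ^ (k + 1)).trace.re ≤ ((X * Xᴴ) ^ 2 ^ k).trace.re) ∧
    ∀ C D : Matrix ι ι ℂ, C.IsHermitian → D.IsHermitian →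
      ((C * D) ^ 2 ^ k).trace.re ≤ (C ^ 2 ^ k * D ^ 2 ^ k).trace.re := by
  induction k with
  | zero =>
    refine ⟨fun X => ?_, fun C D _ _ => by simp⟩
    simpa [pow_two] using trace_re_mul_self_le X
  | succ k ih =>
    obtain ⟨hA, hB⟩ := ih
    constructor
    · intro X
      have hX : (X * Xᴴ).IsHermitian := Matrix.isHermitian_mul_conjTranspose_self X
      have hX' : (Xᴴ * X).IsHermitian := Matrix.isHermitian_conjTranspose_mul_self X
      calc (X ^ 2 ^ (k + 1 + 1)).trace.re = ((X ^ 2) ^ 2 ^ (k + 1)).trace.re := by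
            rw [← pow_mul, pow_succ' 2 (k + 1)]
        _ ≤ ((X ^ 2 * (X ^ 2)ᴴ) ^ 2 ^ k).trace.re := hA _
        _ = ((Xᴴ * X * (X * Xᴴ)) ^ 2 ^ k).trace.re := by
            rw [pow_two X, Matrix.conjTranspose_mul, Matrix.mul_assoc, trace_mul_pow_comm X,
              ← trace_mul_pow_comm (X * Xᴴ)]
            simp only [Matrix.mul_assoc]
        _ ≤ ((Xᴴ * X) ^ 2 ^ k * (X * Xᴴ) ^ 2 ^ k).trace.re := hB _ _ hX' hX
        _ ≤ ((X * Xᴴ) ^ 2 ^ (k + 1)).trace.re := by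
            have h := hs_self_nonneg ((Xᴴ * X) ^ 2 ^ k - (X * Xᴴ) ^ 2 ^ k)
            simp only [hs_sub_left, hs_sub_right] at h
            rw [hs_comm ((X * Xᴴ) ^ 2 ^ k) ((Xᴴ * X) ^ 2 ^ k)] at h
            simp only [hs, (hX.pow _).eq, (hX'.pow _).eq, ← pow_two, ← pow_mul, ← pow_succ] at h
            rw [trace_mul_pow_comm Xᴴ X] at h
            linarith
    · intro C D hC hD
      calc ((C * D) ^ 2 ^ (k + 1)).trace.re
          ≤ ((C * D * (C * D)ᴴ) ^ 2 ^ k).trace.re := hA _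
        _ = ((C ^ 2 * D ^ 2) ^ 2 ^ k).trace.re := by
            rw [Matrix.conjTranspose_mul, hC.eq, hD.eq, ← Matrix.mul_assoc, trace_mul_pow_comm]
            simp only [pow_two, Matrix.mul_assoc]
        _ ≤ ((C ^ 2) ^ 2 ^ k * (D ^ 2) ^ 2 ^ k).trace.re := hB _ _ (hC.pow 2) (hD.pow 2)
        _ = (C ^ 2 ^ (k + 1) * D ^ 2 ^ (k + 1)).trace.re := by
            rw [← pow_mul, ← pow_mul, pow_succ' 2 k]

end GoldenThompson

section LieTrotter
open NormedSpace Filter Topology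

variable {𝔸 : Type*} [NormedRing 𝔸] [NormOneClass 𝔸]

lemma norm_pow_sub_pow_le {U V : 𝔸} {M : ℝ} (hU : ‖U‖ ≤ M) (hV : ‖V‖ ≤ M) (k : ℕ) :
    ‖U ^ k - V ^ k‖ ≤ k * M ^ (k - 1) * ‖U - V‖ := by
  have hM : 0 ≤ M := (norm_nonneg _).trans hU
  induction k with
  | zero => simp
  | succ k ih =>
    have h : U ^ (k + 1) - V ^ (k + 1) = U ^ k * (U - V) + (U ^ k - V ^ k) * V := by
      rw [pow_succ, pow_succ]; noncomm_ring
    have h1 : ‖U ^ k‖ ≤ M ^ k := (norm_pow_le _ _).trans (by gcongr)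
    rcases Nat.eq_zero_or_pos k with rfl | hk
    · simp
    have h2 : M ^ k = M ^ (k - 1) * M := by rw [← pow_succ]; congr 1; omega
    calc ‖U ^ (k + 1) - V ^ (k + 1)‖ ≤ ‖U ^ k * (U - V)‖ + ‖(U ^ k - V ^ k) * V‖ := by
          rw [h]; exact norm_add_le _ _
      _ ≤ ‖U ^ k‖ * ‖U - V‖ + ‖U ^ k - V ^ k‖ * ‖V‖ :=
          add_le_add (norm_mul_le _ _) (norm_mul_le _ _)
      _ ≤ M ^ k * ‖U - V‖ + (k * M ^ (k - 1) * ‖U - V‖) * M := by gcongr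
      _ = _ := by rw [Nat.add_sub_cancel, h2]; push_cast; ring

variable [NormedAlgebra ℝ 𝔸]

lemma norm_exp_smul_le (A : 𝔸) {s : ℝ} (hs : 0 ≤ s) : ‖exp (s • A)‖ ≤ Real.exp (s * ‖A‖) := by
  have h : s * ‖A‖ = ‖s • A‖ := by rw [norm_smul, Real.norm_of_nonneg hs]
  rw [h, Real.exp_eq_exp_ℝ, exp_eq_tsum ℝ, exp_eq_tsum ℝ]
  have h1 := norm_expSeries_summable' (𝕂 := ℝ) ‖s • A‖
  refine (norm_tsum_le_tsum_norm (norm_expSeries_summable' (𝕂 := ℝ) (s • A))).trans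
    ((norm_expSeries_summable' (𝕂 := ℝ) (s • A)).tsum_le_tsum (fun n => ?_) h1.of_norm)
  rw [norm_smul, Real.norm_of_nonneg (by positivity), smul_eq_mul]
  gcongr
  exact norm_pow_le _ _

variable [CompleteSpace 𝔸]

/-- The Lie–Trotter product formula. -/
lemma tendsto_exp_mul_exp_pow (A B : 𝔸) :
    Tendsto (fun k : ℕ => (exp ((k : ℝ)⁻¹ • A) * exp ((k : ℝ)⁻¹ • B)) ^ k) atTop
      (𝓝 (exp (A + B))) := by
  set f : ℝ → 𝔸 := fun s => exp (s • A) * exp (s • B) - exp (s • (A + B)) with hf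
  have hd : HasDerivAt f 0 0 := by
    have h := ((hasDerivAt_exp_smul_const A (0 : ℝ)).mul
      (hasDerivAt_exp_smul_const B (0 : ℝ))).sub (hasDerivAt_exp_smul_const (A + B) (0 : ℝ))
    exact h.congr_deriv (by simp)
  have hlim : Tendsto (fun k : ℕ => (k : ℝ) • f (k : ℝ)⁻¹) atTop (𝓝 0) := by
    have h := hasDerivAt_iff_tendsto_slope_zero.1 hd
    have h1 : Tendsto (fun k : ℕ => (k : ℝ)⁻¹) atTop (𝓝[≠] 0) :=
      tendsto_nhdsWithin_iff.2 ⟨tendsto_inv_atTop_nhds_zero_nat,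
        (eventually_gt_atTop 0).mono fun k hk => by simp [hk.ne']⟩
    refine (h.comp h1).congr fun k => ?_
    simp [hf]
  rw [tendsto_iff_norm_sub_tendsto_zero]
  have hlim' := (hlim.norm.const_mul (Real.exp (‖A‖ + ‖B‖)))
  rw [norm_zero, mul_zero] at hlim'
  refine squeeze_zero' (Eventually.of_forall fun _ => norm_nonneg _) ?_ hlim'
  filter_upwards [eventually_gt_atTop 0] with k hk
  have hk0 : (0 : ℝ) < k := by exact_mod_cast hk
  have hinv : (0 : ℝ) ≤ (k : ℝ)⁻¹ := by positivity
  have hV : exp (A + B) = exp ((k : ℝ)⁻¹ • (A + B)) ^ k := by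
    let := NormedAlgebra.restrictScalars ℚ ℝ 𝔸
    rw [← exp_nsmul, ← Nat.cast_smul_eq_nsmul ℝ, smul_smul, mul_inv_cancel₀ hk0.ne', one_smul]
  set M := Real.exp ((k : ℝ)⁻¹ * (‖A‖ + ‖B‖)) with hM
  have hU1 : ‖exp ((k : ℝ)⁻¹ • A) * exp ((k : ℝ)⁻¹ • B)‖ ≤ M := by
    refine (norm_mul_le _ _).trans ?_
    rw [hM, mul_add, Real.exp_add]
    exact mul_le_mul (norm_exp_smul_le A hinv) (norm_exp_smul_le B hinv) (norm_nonneg _)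
      (Real.exp_nonneg _)
  have hV1 : ‖exp ((k : ℝ)⁻¹ • (A + B))‖ ≤ M := by
    refine (norm_exp_smul_le _ hinv).trans (Real.exp_le_exp.2 ?_)
    gcongr
    exact norm_add_le _ _
  rw [hV]
  refine (norm_pow_sub_pow_le hU1 hV1 k).trans ?_
  have hMk : M ^ (k - 1) ≤ Real.exp (‖A‖ + ‖B‖) := by
    rw [hM, ← Real.exp_nat_mul, Real.exp_le_exp, ← mul_assoc]
    refine mul_le_of_le_one_left (by positivity) ?_
    rw [← div_eq_mul_inv, div_le_one hk0]
    exact_mod_cast Nat.sub_le k 1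
  rw [norm_smul, Real.norm_of_nonneg hk0.le]
  calc (k : ℝ) * M ^ (k - 1) * _ ≤ k * Real.exp (‖A‖ + ‖B‖) * _ := by gcongr
    _ = _ := by rw [hf]; ring

end LieTrotter

section TraceInequality

open NormedSpace Filter Topology

attribute [local instance] Matrix.linftyOpNormedRing Matrix.linftyOpNormedAlgebra

variable {ι : Type*} [Fintype ι] [DecidableEq ι]

/-- The **Golden–Thompson inequality**. -/
theorem trace_exp_add_le {A B : Matrix ι ι ℂ} (hA : A.IsHermitian) (hB : B.IsHermitian) :
    (exp (A + B)).trace.re ≤ (exp A * exp B).trace.re := by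
  rcases isEmpty_or_nonempty ι with hι | hι
  · simp [Matrix.trace]
  have hlim := (tendsto_exp_mul_exp_pow A B).comp (tendsto_pow_atTop_atTop_of_one_lt one_lt_two)
  have hc : Continuous fun X : Matrix ι ι ℂ => X.trace.re :=
    Complex.continuous_re.comp continuous_id.matrix_trace
  refine le_of_tendsto ((hc.tendsto _).comp hlim) (Eventually.of_forall fun k => ?_)
  have h0 : ((2 ^ k : ℕ) : ℝ) ≠ 0 := by positivity
  have hr : ∀ X : Matrix ι ι ℂ, exp (((2 ^ k : ℕ) : ℝ)⁻¹ • X) ^ 2 ^ k = exp X := fun X => by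
    rw [← Matrix.exp_nsmul, ← Nat.cast_smul_eq_nsmul ℝ, smul_smul, mul_inv_cancel₀ h0, one_smul]
  have h := (trace_pow_two_pow_le k).2 _ _ (real_smul_isHermitian hA ((2 ^ k : ℕ) : ℝ)⁻¹).exp
    (real_smul_isHermitian hB ((2 ^ k : ℕ) : ℝ)⁻¹).exp
  rw [hr, hr] at h
  exact h

end TraceInequality


/-! ### The trace norm and positivity -/

section TraceNorm

variable {n : ℕ}

/-- In an orthonormal basis of right singular vectors, the columns of `σ` are orthogonal, and their
norms are the singular values. -/
lemma exists_unitary_conj_eq_diagonal (σ : Operator n) :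
    ∃ U G : Operator n, U * Uᴴ = 1 ∧ Uᴴ * U = 1 ∧ σ = U * G * Uᴴ ∧
      Gᴴ * G = Matrix.diagonal fun x =>
        (((Matrix.isHermitian_conjTranspose_mul_self σ).eigenvalues x : ℝ) : ℂ) := by
  set hσ := Matrix.isHermitian_conjTranspose_mul_self σ
  set U : Operator n := hσ.eigenvectorUnitary.1 with hU
  have h1 : U * Uᴴ = 1 := Matrix.mem_unitaryGroup_iff.1 hσ.eigenvectorUnitary.2
  have h2 : Uᴴ * U = 1 := Matrix.mem_unitaryGroup_iff'.1 hσ.eigenvectorUnitary.2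
  refine ⟨U, Uᴴ * σ * U, h1, h2, ?_, ?_⟩
  · calc σ = (U * Uᴴ) * σ * (U * Uᴴ) := by rw [h1, one_mul, mul_one]
      _ = _ := by simp only [Matrix.mul_assoc]
  · have h := hσ.spectral_theorem
    rw [Unitary.conjStarAlgAut_apply] at h
    have h3 : (Uᴴ * σ * U)ᴴ * (Uᴴ * σ * U) = Uᴴ * (σᴴ * σ) * U := by
      simp only [Matrix.conjTranspose_mul, Matrix.conjTranspose_conjTranspose]
      calc Uᴴ * (σᴴ * U) * (Uᴴ * σ * U) = Uᴴ * σᴴ * (U * Uᴴ) * σ * U := by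
            simp only [Matrix.mul_assoc]
        _ = _ := by rw [h1, mul_one]; simp only [Matrix.mul_assoc]
    rw [h3]
    conv_lhs => rw [h]
    change Uᴴ * (U * _ * Uᴴ) * U = _
    calc Uᴴ * (U * Matrix.diagonal (RCLike.ofReal ∘ hσ.eigenvalues) * Uᴴ) * U
        = (Uᴴ * U) * Matrix.diagonal (RCLike.ofReal ∘ hσ.eigenvalues) * (Uᴴ * U) := by
          simp only [Matrix.mul_assoc]
      _ = _ := by rw [h2, one_mul, mul_one]; rfl

lemma sum_normSq_col {G : Operator n} {l : Basis n → ℝ}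
    (h : Gᴴ * G = Matrix.diagonal fun x => (l x : ℂ)) (x : Basis n) :
    ∑ y, Complex.normSq (G y x) = l x := by
  have h1 := congrFun (congrFun h x) x
  rw [Matrix.diagonal_apply_eq, Matrix.mul_apply] at h1
  have h2 : ∀ y, Gᴴ x y * G y x = (Complex.normSq (G y x) : ℂ) := fun y => by
    rw [Matrix.conjTranspose_apply, Complex.normSq_eq_conj_mul_self]; rfl
  simp only [h2] at h1
  exact_mod_cast h1

lemma trace_conj_unitary {U : Operator n} (hU : Uᴴ * U = 1) (G : Operator n) :
    (U * G * Uᴴ).trace = G.trace := by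
  rw [Matrix.trace_mul_comm, ← Matrix.mul_assoc, hU, one_mul]

lemma re_apply_le_sqrt {G : Operator n} {l : Basis n → ℝ}
    (h : Gᴴ * G = Matrix.diagonal fun x => (l x : ℂ)) (x : Basis n) :
    (G x x).re ≤ Real.sqrt (l x) := by
  apply Real.le_sqrt_of_sq_le
  rw [← sum_normSq_col h x]
  refine le_trans ?_ (Finset.single_le_sum (f := fun y => Complex.normSq (G y x))
    (fun y _ => Complex.normSq_nonneg _) (Finset.mem_univ x))
  simp only [Complex.normSq_apply]
  nlinarith [mul_self_nonneg (G x x).im]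

lemma re_trace_le_traceNorm (σ : Operator n) : σ.trace.re ≤ traceNorm σ := by
  obtain ⟨U, G, -, h2, hσ, hG⟩ := exists_unitary_conj_eq_diagonal σ
  have h : σ.trace = G.trace := by conv_lhs => rw [hσ, trace_conj_unitary h2]
  rw [h, Matrix.trace, Complex.re_sum]
  exact Finset.sum_le_sum fun x _ => re_apply_le_sqrt hG x

/-- The equality case of `re_trace_le_traceNorm`. -/
lemma posSemidef_of_traceNorm_le {σ : Operator n} (h : traceNorm σ ≤ σ.trace.re) :
    σ.PosSemidef := by
  obtain ⟨U, G, -, h2, hσ, hG⟩ := exists_unitary_conj_eq_diagonal σ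
  set l := (Matrix.isHermitian_conjTranspose_mul_self σ).eigenvalues with hl
  have ht : σ.trace = G.trace := by conv_lhs => rw [hσ, trace_conj_unitary h2]
  rw [ht, Matrix.trace, Complex.re_sum] at h
  have heq : ∀ x, (G x x).re = Real.sqrt (l x) := fun x =>
    (Finset.sum_eq_sum_iff_of_le fun x _ => re_apply_le_sqrt hG x).1
      (le_antisymm (Finset.sum_le_sum fun x _ => re_apply_le_sqrt hG x) h) x (Finset.mem_univ x)
  have hl0 : ∀ x, 0 ≤ l x := Matrix.eigenvalues_conjTranspose_mul_self_nonneg σ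
  have hGd : G = Matrix.diagonal fun x => ((Real.sqrt (l x) : ℝ) : ℂ) := by
    ext y x
    -- the diagonal entry alone exhausts the norm of its column
    have hc := sum_normSq_col hG x
    rw [← Finset.add_sum_erase _ _ (Finset.mem_univ x), Complex.normSq_apply, heq,
      Real.mul_self_sqrt (hl0 x)] at hc
    have h0 : 0 ≤ ∑ y ∈ Finset.univ.erase x, Complex.normSq (G y x) :=
      Finset.sum_nonneg fun y _ => Complex.normSq_nonneg _
    have him : (G x x).im = 0 := by nlinarith [mul_self_nonneg (G x x).im]
    by_cases hyx : y = x
    · subst hyx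
      rw [Matrix.diagonal_apply_eq]
      exact Complex.ext (by simp [heq]) (by simp [him])
    · rw [Matrix.diagonal_apply_ne _ hyx]
      have h1 : ∑ y ∈ Finset.univ.erase x, Complex.normSq (G y x) = 0 := by
        rw [him] at hc; linarith
      exact Complex.normSq_eq_zero.1 ((Finset.sum_eq_zero_iff_of_nonneg
        fun y _ => Complex.normSq_nonneg _).1 h1 y (by simp [hyx]))
  rw [hσ]
  refine Matrix.PosSemidef.mul_mul_conjTranspose_same ?_ U
  rw [hGd]
  exact Matrix.PosSemidef.diagonal fun x => by
    simp

open scoped MatrixOrder in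
lemma traceNorm_of_posSemidef {ρ : Operator n} (hρ : ρ.PosSemidef) :
    traceNorm ρ = ρ.trace.re := by
  obtain ⟨U, G, h1, h2, hσ, hG⟩ := exists_unitary_conj_eq_diagonal ρ
  set l := (Matrix.isHermitian_conjTranspose_mul_self ρ).eigenvalues with hl
  have hl0 : ∀ x, 0 ≤ l x := Matrix.eigenvalues_conjTranspose_mul_self_nonneg ρ
  have ht : ρ.trace = G.trace := by conv_lhs => rw [hσ, trace_conj_unitary h2]
  have hGp : G.PosSemidef := by
    have h : G = Uᴴ * ρ * U := by
      rw [hσ]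
      calc G = (Uᴴ * U) * G * (Uᴴ * U) := by rw [h2, one_mul, mul_one]
        _ = _ := by simp only [Matrix.mul_assoc]
    rw [h]
    exact hρ.conjTranspose_mul_mul_same U
  have hDp : (Matrix.diagonal fun x => ((Real.sqrt (l x) : ℝ) : ℂ)).PosSemidef :=
    Matrix.PosSemidef.diagonal fun x => by
      simp
  have hD : (Matrix.diagonal fun x => ((Real.sqrt (l x) : ℝ) : ℂ)) *
      (Matrix.diagonal fun x => ((Real.sqrt (l x) : ℝ) : ℂ)) =
      Matrix.diagonal fun x => (l x : ℂ) := by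
    rw [Matrix.diagonal_mul_diagonal]
    congr 1; ext x
    rw [← Complex.ofReal_mul, Real.mul_self_sqrt (hl0 x)]
  rw [hGp.isHermitian.eq] at hG
  have hG' : G = Matrix.diagonal fun x => ((Real.sqrt (l x) : ℝ) : ℂ) := by
    rw [← CFC.sqrt_unique hG (Matrix.nonneg_iff_posSemidef.2 hGp),
      CFC.sqrt_unique hD (Matrix.nonneg_iff_posSemidef.2 hDp)]
  rw [ht, hG', Matrix.trace_diagonal, Complex.re_sum]
  rfl

/-- A state is the unique solution of the trace norm program for its own data as soon as it is the
only positive semidefinite feasible matrix: a feasible matrix has trace one, so its trace norm is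
at least one, with equality only if it is positive semidefinite. -/
lemma solutions_eq_singleton {m : ℕ} {ρ : Operator n} (hρ : IsDensityMatrix ρ)
    (A : Fin m → PauliLabel n)
    (h : ∀ σ : Operator n, σ.PosSemidef → σ.trace = 1 →
      expectations A σ = expectations A ρ → σ = ρ) :
    solutions A (expectations A ρ) = {ρ} := by
  have h1 : traceNorm ρ = 1 := by
    rw [traceNorm_of_posSemidef hρ.posSemidef, hρ.trace_eq_one, Complex.one_re]
  have hf : ρ ∈ feasible A (expectations A ρ) := ⟨hρ.trace_eq_one, rfl⟩
  have h2 : ∀ τ ∈ feasible A (expectations A ρ), 1 ≤ traceNorm τ := fun τ hτ => by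
    have := re_trace_le_traceNorm τ
    rwa [hτ.1, Complex.one_re] at this
  ext σ
  rw [Set.mem_singleton_iff]
  constructor
  · rintro ⟨hσ, hmin⟩
    refine h σ (posSemidef_of_traceNorm_le ?_) hσ.1 hσ.2
    rw [hσ.1, Complex.one_re, ← h1]
    exact hmin ρ hf
  · rintro rfl
    exact ⟨hf, fun τ hτ => h1 ▸ h2 τ hτ⟩

end TraceNorm

/-! ### Tight frames of Hermitian unitaries -/

section Frame

variable {ι L : Type*} [Fintype ι] [DecidableEq ι] [Fintype L]

/-- A family of `d²` Hermitian unitaries of size `d` which, up to scaling, is an orthonormal basis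
of the real space of Hermitian matrices; orthonormality is expressed by the expansion of a Hermitian
matrix. -/
structure IsUnitaryFrame (w : L → Matrix ι ι ℂ) : Prop where
  isHermitian : ∀ a, (w a).IsHermitian
  mul_self : ∀ a, w a * w a = 1
  card_eq : Fintype.card L = Fintype.card ι ^ 2
  sum_hs_smul : ∀ F : Matrix ι ι ℂ, F.IsHermitian →
    ∑ a, hs (w a) F • w a = (Fintype.card ι : ℝ) • F

variable {w : L → Matrix ι ι ℂ}

lemma IsUnitaryFrame.sum_hs_sq (hw : IsUnitaryFrame w) {F : Matrix ι ι ℂ} (hF : F.IsHermitian) :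
    ∑ a, hs (w a) F ^ 2 = Fintype.card ι * hs F F := by
  rw [← hs_smul_left, ← hw.sum_hs_smul F hF, hs_sum_left]
  exact Finset.sum_congr rfl fun a _ => by rw [hs_smul_left, pow_two]

end Frame

section PauliFrame

variable {n : ℕ}

lemma pauli1_isHermitian (a : Fin 4) : (pauli1 a).IsHermitian := by
  ext i j
  fin_cases a <;> fin_cases i <;> fin_cases j <;> simp [pauli1]

lemma pauli1_mul_self (a : Fin 4) : pauli1 a * pauli1 a = 1 := by
  ext i j
  fin_cases a <;> fin_cases i <;> fin_cases j <;> simp [pauli1, Matrix.mul_apply]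

lemma sum_pauli1_mul (i j k l : Fin 2) :
    ∑ a, pauli1 a i j * pauli1 a k l = if i = l ∧ j = k then 2 else 0 := by
  fin_cases i <;> fin_cases j <;> fin_cases k <;> fin_cases l <;>
    simp [pauli1, Fin.sum_univ_four] <;> norm_num

lemma pauli_isHermitian (a : PauliLabel n) : (pauli a).IsHermitian := by
  ext x y
  simp only [pauli, Matrix.conjTranspose_apply, Matrix.of_apply, star_prod]
  exact Finset.prod_congr rfl fun k _ => (pauli1_isHermitian (a k)).apply _ _

lemma pauli_mul_self (a : PauliLabel n) : pauli a * pauli a = 1 := by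
  ext x y
  simp only [pauli, Matrix.mul_apply, Matrix.of_apply, ← Finset.prod_mul_distrib]
  rw [← Fintype.prod_sum (fun k z => pauli1 (a k) (x k) z * pauli1 (a k) z (y k))]
  simp only [← Matrix.mul_apply, pauli1_mul_self, Matrix.one_apply]
  rw [Finset.prod_ite_zero]
  simp [funext_iff]

lemma sum_pauli_mul (x y x' y' : Basis n) :
    ∑ a : PauliLabel n, pauli a x y * pauli a x' y' = if x = y' ∧ y = x' then 2 ^ n else 0 := by
  simp only [pauli, Matrix.of_apply, ← Finset.prod_mul_distrib]
  rw [← Fintype.prod_sum (fun k b => pauli1 b (x k) (y k) * pauli1 b (x' k) (y' k))]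
  simp only [sum_pauli1_mul]
  rw [Finset.prod_ite_zero]
  simp [funext_iff, forall_and]

lemma pauli_isUnitaryFrame : IsUnitaryFrame (pauli (n := n)) where
  isHermitian := pauli_isHermitian
  mul_self := pauli_mul_self
  card_eq := by simp [← pow_mul, mul_comm n 2]; norm_num [pow_mul]
  sum_hs_smul F hF := by
    have hre : ∀ a : PauliLabel n, ((hs (pauli a) F : ℝ) : ℂ) = (pauli a * F).trace := fun a => by
      rw [hs, (pauli_isHermitian a).eq]
      apply Complex.conj_eq_iff_re.1
      have := Matrix.trace_conjTranspose (pauli a * F)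
      rw [Matrix.conjTranspose_mul, hF.eq, (pauli_isHermitian a).eq, Matrix.trace_mul_comm] at this
      exact this.symm
    ext x' y'
    simp only [Matrix.sum_apply, Matrix.smul_apply, Complex.real_smul, hre, Matrix.trace,
      Matrix.diag_apply, Matrix.mul_apply, Finset.sum_mul]
    rw [Finset.sum_comm]
    simp only [mul_right_comm _ (F _ _)]
    rw [Finset.sum_congr rfl fun _ _ => Finset.sum_comm]
    simp only [← Finset.sum_mul, sum_pauli_mul]
    simp [ite_and]

end PauliFrame

/-! ### The tangent space of a state -/

section Tangent

variable {ι : Type*} [Fintype ι]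

/-- The orthogonal projection onto the tangent space of the matrices of bounded rank at a Hermitian
matrix with kernel projection `Q`: the matrices whose compression by `Q` vanishes. -/
def tangentProj (Q X : Matrix ι ι ℂ) : Matrix ι ι ℂ := X - Q * X * Q

variable {Q : Matrix ι ι ℂ}

lemma tangentProj_isHermitian (hQ : Q.IsHermitian) {X : Matrix ι ι ℂ} (hX : X.IsHermitian) :
    (tangentProj Q X).IsHermitian := by
  refine hX.sub ?_
  rw [Matrix.IsHermitian, Matrix.conjTranspose_mul, Matrix.conjTranspose_mul, hQ.eq, hX.eq,
    Matrix.mul_assoc]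

lemma conj_conj_eq (hQ : Q * Q = Q) (X : Matrix ι ι ℂ) : Q * (Q * X * Q) * Q = Q * X * Q := by
  calc Q * (Q * X * Q) * Q = (Q * Q) * X * (Q * Q) := by simp only [Matrix.mul_assoc]
    _ = _ := by rw [hQ]

lemma conj_tangentProj (hQ : Q * Q = Q) (X : Matrix ι ι ℂ) : Q * tangentProj Q X * Q = 0 := by
  rw [tangentProj, Matrix.mul_sub, Matrix.sub_mul, conj_conj_eq hQ, sub_self]

lemma hs_tangentProj_left (hQ : Q.IsHermitian) (X Y : Matrix ι ι ℂ) :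
    hs (tangentProj Q X) Y = hs X (tangentProj Q Y) := by
  rw [tangentProj, tangentProj, hs_sub_left, hs_sub_right, hs_conj _ _ hQ]

lemma tangentProj_eq_self {F : Matrix ι ι ℂ} (hF : Q * F * Q = 0) : tangentProj Q F = F := by
  rw [tangentProj, hF, sub_zero]

lemma tangentProj_add (X Y : Matrix ι ι ℂ) :
    tangentProj Q (X + Y) = tangentProj Q X + tangentProj Q Y := by
  simp only [tangentProj, Matrix.mul_add, Matrix.add_mul]; abel

lemma tangentProj_smul (s : ℝ) (X : Matrix ι ι ℂ) :
    tangentProj Q (s • X) = s • tangentProj Q X := by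
  simp only [tangentProj, Matrix.mul_smul, Matrix.smul_mul, smul_sub]

variable [DecidableEq ι]

/-- This is where it matters that the Pauli matrices are unitary: none of them is concentrated on
the tangent space. -/
lemma hs_tangentProj_self_le (hQ : Q.IsHermitian) (hQQ : Q * Q = Q) {w : Matrix ι ι ℂ}
    (hw : w.IsHermitian) (hww : w * w = 1) :
    hs (tangentProj Q w) (tangentProj Q w) ≤ 2 * (1 - Q).trace.re := by
  have h := hs_self_nonneg ((1 - Q) * w * (1 - Q))
  have hP : (1 - Q).IsHermitian := Matrix.isHermitian_one.sub hQ
  have hPP : (1 - Q) * (1 - Q) = 1 - Q := by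
    rw [Matrix.sub_mul, Matrix.mul_sub, Matrix.mul_sub, hQQ]; simp
  rw [hs_conj _ _ hP, conj_conj_eq hPP] at h
  rw [hs_tangentProj_left hQ, tangentProj_eq_self (conj_tangentProj hQQ w), tangentProj,
    hs_sub_right]
  simp only [hs, hw.eq, hww] at h ⊢
  have e : w * ((1 - Q) * w * (1 - Q)) = 1 - Q - w * Q * w + w * (Q * w * Q) := by
    calc w * ((1 - Q) * w * (1 - Q)) = w * w - w * w * Q - w * Q * w + w * (Q * w * Q) := by
          noncomm_ring
      _ = _ := by rw [hww, one_mul]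
  have e2 : (w * Q * w).trace = Q.trace := by
    rw [Matrix.trace_mul_comm, ← Matrix.mul_assoc, hww, one_mul]
  rw [e, Matrix.trace_add, Matrix.trace_sub, e2, Matrix.trace_sub] at h
  rw [Matrix.trace_sub]
  simp only [Complex.add_re, Complex.sub_re] at h ⊢
  linarith

lemma conj_mul_conj_le_one (hQ : Q.IsHermitian) (hQQ : Q * Q = Q) {w : Matrix ι ι ℂ}
    (hw : w.IsHermitian) (hww : w * w = 1) :
    (1 - (Q * w * Q) * (Q * w * Q)).PosSemidef := by
  have hP : (1 - Q).IsHermitian := Matrix.isHermitian_one.sub hQ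
  have hPP : (1 - Q) * (1 - Q) = 1 - Q := by
    rw [Matrix.sub_mul, Matrix.mul_sub, Matrix.mul_sub, hQQ]; simp
  have hpos : (1 - Q).PosSemidef := by
    have := Matrix.posSemidef_conjTranspose_mul_self (1 - Q)
    rwa [hP.eq, hPP] at this
  have e : 1 - (Q * w * Q) * (Q * w * Q) = (1 - Q) + (Q * w) * (1 - Q) * (Q * w)ᴴ := by
    rw [Matrix.conjTranspose_mul, hQ.eq, hw.eq]
    have e1 : (Q * w) * (1 - Q) * (w * Q) = Q * (w * w) * Q - Q * w * Q * w * Q := by noncomm_ring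
    have e2 : (Q * w * Q) * (Q * w * Q) = Q * w * (Q * Q) * w * Q := by noncomm_ring
    rw [e1, e2, hww, hQQ, mul_one, hQQ]
    abel
  rw [e]
  exact hpos.add (hpos.mul_mul_conjTranspose_same _)

end Tangent

/-! ### Exponentials of Hermitian matrices -/

section Exp

open NormedSpace

variable {ι : Type*} [Fintype ι] [DecidableEq ι]

open scoped MatrixOrder in
lemma trace_mul_nonneg {A B : Matrix ι ι ℂ} (hA : A.PosSemidef) (hB : B.PosSemidef) :
    0 ≤ (A * B).trace.re := by
  obtain ⟨C, rfl⟩ := CStarAlgebra.nonneg_iff_eq_star_mul_self.1 hA.nonneg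
  have h := (hB.mul_mul_conjTranspose_same C).trace_nonneg
  rw [Matrix.mul_assoc, Matrix.trace_mul_comm, Matrix.star_eq_conjTranspose]
  exact (Complex.le_def.1 h).1

lemma exp_posSemidef {H : Matrix ι ι ℂ} (hH : H.IsHermitian) : (exp H).PosSemidef := by
  have h := Matrix.posSemidef_conjTranspose_mul_self (exp ((1 / 2 : ℝ) • H))
  rw [(real_smul_isHermitian hH _).exp.eq, ← pow_two, ← Matrix.exp_nsmul,
    ← Nat.cast_smul_eq_nsmul ℝ, smul_smul] at h
  norm_num at h
  exact h

lemma exp_sub_sq_le {x b : ℝ} (hxb : x ^ 2 ≤ b ^ 2) (hb : b ^ 2 ≤ 1 / 4) :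
    Real.exp (-b ^ 2) * Real.exp x ≤ 1 + x := by
  have hx : |x| ≤ 1 / 2 := abs_le_of_sq_le_sq (by linarith) (by norm_num)
  obtain ⟨h1, h2⟩ := abs_le.1 hx
  rw [← Real.exp_add]
  refine (Real.exp_le_exp.2 (show -b ^ 2 + x ≤ -(x ^ 2 - x) by linarith)).trans ?_
  rw [Real.exp_neg, inv_le_comm₀ (Real.exp_pos _) (by linarith)]
  rw [inv_eq_one_div, div_le_iff₀ (by linarith)]
  rcases le_total 0 x with h0 | h0
  · have := Real.add_one_le_exp (x ^ 2 - x)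
    nlinarith [pow_nonneg h0 3]
  · have := Real.quadratic_le_exp_of_nonneg (show 0 ≤ x ^ 2 - x by nlinarith)
    have h3 : 0 ≤ 1 + x := by linarith
    have h4 : 0 ≤ 1 + x - x ^ 2 + x ^ 3 := by nlinarith [sq_nonneg x, mul_nonneg h3 (sq_nonneg x)]
    nlinarith [mul_le_mul_of_nonneg_right this h3, mul_nonneg (sq_nonneg x) h4]

lemma exists_diagonalization {X : Matrix ι ι ℂ} (hX : X.IsHermitian) :
    ∃ U : Matrix ι ι ℂ, U * Uᴴ = 1 ∧ Uᴴ * U = 1 ∧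
      X = U * (Matrix.diagonal fun i => (hX.eigenvalues i : ℂ)) * Uᴴ ∧
      ∀ s : ℝ, exp (s • X) =
        U * (Matrix.diagonal fun i => (Real.exp (s * hX.eigenvalues i) : ℂ)) * Uᴴ := by
  set U : Matrix ι ι ℂ := hX.eigenvectorUnitary.1 with hU
  have h1 : U * Uᴴ = 1 := Matrix.mem_unitaryGroup_iff.1 hX.eigenvectorUnitary.2
  have h2 : Uᴴ * U = 1 := Matrix.mem_unitaryGroup_iff'.1 hX.eigenvectorUnitary.2
  have hinv : U⁻¹ = Uᴴ := Matrix.inv_eq_left_inv h2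
  have hUu : IsUnit U := IsUnit.of_mul_eq_one _ h1
  have hs : X = U * (Matrix.diagonal fun i => (hX.eigenvalues i : ℂ)) * Uᴴ := by
    have h := hX.spectral_theorem
    rw [Unitary.conjStarAlgAut_apply] at h
    exact h
  refine ⟨U, h1, h2, hs, fun s => ?_⟩
  conv_lhs => rw [hs]
  rw [← Matrix.smul_mul, ← Matrix.mul_smul, ← hinv, Matrix.exp_conj _ _ hUu,
    ← Matrix.diagonal_smul, Matrix.exp_diagonal]
  congr 3
  ext i
  rw [Pi.coe_exp, ← Complex.exp_eq_exp_ℂ, Complex.ofReal_exp]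
  simp

/-- A matrix version of `exp (x - b ^ 2) ≤ 1 + x`, for `|x| ≤ b ≤ 1 / 2`. -/
lemma one_add_sub_exp_posSemidef {X : Matrix ι ι ℂ} (hX : X.IsHermitian) {b : ℝ}
    (hXb : ((b ^ 2) • (1 : Matrix ι ι ℂ) - X * X).PosSemidef) (hb : b ^ 2 ≤ 1 / 4) :
    (1 + X - Real.exp (-b ^ 2) • exp X).PosSemidef := by
  obtain ⟨U, h1, h2, hs, hexp⟩ := exists_diagonalization hX
  generalize hX.eigenvalues = l at hs hexp
  have hexp := hexp 1
  simp only [one_smul, one_mul] at hexp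
  set D : Matrix ι ι ℂ := Matrix.diagonal fun i => (l i : ℂ) with hD
  have heig : ∀ i, l i ^ 2 ≤ b ^ 2 := fun i => by
    have h := (hXb.conjTranspose_mul_mul_same U).diag_nonneg (i := i)
    have e : Uᴴ * ((b ^ 2) • (1 : Matrix ι ι ℂ) - X * X) * U =
        (b ^ 2) • (1 : Matrix ι ι ℂ) - D * D := by
      have e1 : Uᴴ * (X * X) * U = (Uᴴ * U) * D * (Uᴴ * U) * D * (Uᴴ * U) := by
        conv_lhs => rw [hs]
        simp only [Matrix.mul_assoc]
      rw [Matrix.mul_sub, Matrix.sub_mul, e1, h2, Matrix.mul_smul, Matrix.smul_mul, mul_one, h2]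
      simp
    rw [e, hD, Matrix.diagonal_mul_diagonal, Matrix.sub_apply, Matrix.smul_apply,
      Matrix.one_apply_eq, Matrix.diagonal_apply_eq, Complex.le_def] at h
    have := h.1
    rw [Complex.sub_re, Complex.smul_re, ← Complex.ofReal_mul, Complex.ofReal_re, Complex.one_re,
      Complex.zero_re, smul_eq_mul] at this
    linarith [pow_two (l i)]
  have e : 1 + X - Real.exp (-b ^ 2) • exp X = U * (Matrix.diagonal fun i =>
      ((1 + l i - Real.exp (-b ^ 2) * Real.exp (l i) : ℝ) : ℂ)) * Uᴴ := by
    have e1 : (Matrix.diagonal fun i =>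
      ((1 + l i - Real.exp (-b ^ 2) * Real.exp (l i) : ℝ) : ℂ)) =
      1 + D - Real.exp (-b ^ 2) •
        (Matrix.diagonal fun i => ((Real.exp (l i) : ℝ) : ℂ)) := by
      rw [hD, ← Matrix.diagonal_one, Matrix.diagonal_add, ← Matrix.diagonal_smul,
        Matrix.diagonal_sub]
      congr 1; ext i; simp
    rw [e1, Matrix.mul_sub, Matrix.sub_mul, Matrix.mul_add, Matrix.add_mul, mul_one, h1, ← hs,
      Matrix.mul_smul, Matrix.smul_mul, ← hexp]
  rw [e]
  refine Matrix.PosSemidef.mul_mul_conjTranspose_same (Matrix.PosSemidef.diagonal fun i => ?_) U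
  exact Complex.zero_le_real.2 (sub_nonneg.2 (exp_sub_sq_le (heig i) hb))

/-- A Hermitian matrix with an eigenvalue above `x` is detected by the trace of its exponential. -/
lemma exp_le_trace_exp {X : Matrix ι ι ℂ} (hX : X.IsHermitian) {x s : ℝ} (hs : 0 ≤ s)
    (h : ¬ (x • (1 : Matrix ι ι ℂ) - X).PosSemidef) :
    Real.exp (s * x) ≤ (exp (s • X)).trace.re := by
  obtain ⟨U, h1, h2, hX', hexp⟩ := exists_diagonalization hX
  generalize hX.eigenvalues = l at hX' hexp
  have htr : (exp (s • X)).trace.re = ∑ i, Real.exp (s * l i) := by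
    rw [hexp, Matrix.trace_mul_comm, ← Matrix.mul_assoc, h2, one_mul, Matrix.trace_diagonal,
      Complex.re_sum]
    rfl
  have hl : ∃ i, x < l i := by
    by_contra! hl
    apply h
    have e : x • (1 : Matrix ι ι ℂ) - X =
        U * (Matrix.diagonal fun i => ((x - l i : ℝ) : ℂ)) * Uᴴ := by
      have e1 : (Matrix.diagonal fun i => ((x - l i : ℝ) : ℂ)) =
          x • (1 : Matrix ι ι ℂ) - Matrix.diagonal fun i => (l i : ℂ) := by
        rw [← Matrix.diagonal_one, ← Matrix.diagonal_smul, Matrix.diagonal_sub]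
        congr 1; ext i; simp
      rw [e1, Matrix.mul_sub, Matrix.sub_mul, ← hX', Matrix.mul_smul, Matrix.smul_mul, mul_one, h1]
    rw [e]
    exact Matrix.PosSemidef.mul_mul_conjTranspose_same (Matrix.PosSemidef.diagonal fun i =>
      Complex.zero_le_real.2 (sub_nonneg.2 (hl i))) U
  obtain ⟨i, hi⟩ := hl
  rw [htr]
  refine le_trans (Real.exp_le_exp.2 (mul_le_mul_of_nonneg_left hi.le hs)) ?_
  exact Finset.single_le_sum (f := fun i => Real.exp (s * l i))
    (fun i _ => (Real.exp_pos _).le) (Finset.mem_univ i)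

lemma hs_self_le_trace_sq {D : Matrix ι ι ℂ} (hD : D.PosSemidef) :
    hs D D ≤ D.trace.re ^ 2 := by
  obtain ⟨U, h1, h2, hs', -⟩ := exists_diagonalization hD.isHermitian
  have hl := hD.eigenvalues_nonneg
  generalize hD.isHermitian.eigenvalues = l at hs' hl
  have e1 : D.trace.re = ∑ i, l i := by
    rw [hs', Matrix.trace_mul_comm, ← Matrix.mul_assoc, h2, one_mul, Matrix.trace_diagonal,
      Complex.re_sum]
    rfl
  have e2 : hs D D = ∑ i, l i * l i := by
    have e3 : Dᴴ * D = U * ((Matrix.diagonal fun i => (l i : ℂ)) *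
        (Matrix.diagonal fun i => (l i : ℂ))) * Uᴴ := by
      rw [hD.isHermitian.eq]
      calc D * D = U * (Matrix.diagonal fun i => (l i : ℂ)) * (Uᴴ * U) *
            (Matrix.diagonal fun i => (l i : ℂ)) * Uᴴ := by
            conv_lhs => rw [hs']
            simp only [Matrix.mul_assoc]
        _ = _ := by rw [h2]; simp only [mul_one, Matrix.mul_assoc]
    rw [hs, e3, Matrix.trace_mul_comm, ← Matrix.mul_assoc, h2, one_mul,
      Matrix.diagonal_mul_diagonal, Matrix.trace_diagonal, Complex.re_sum]
    exact Finset.sum_congr rfl fun i _ => by rw [← Complex.ofReal_mul, Complex.ofReal_re]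
  rw [e1, e2, pow_two, Finset.sum_mul]
  exact Finset.sum_le_sum fun i _ => mul_le_mul_of_nonneg_left
    (Finset.single_le_sum (fun i _ => hl i) (Finset.mem_univ i)) (hl i)

lemma exists_kernel_projection {X : Matrix ι ι ℂ} (hX : X.IsHermitian) :
    ∃ Q : Matrix ι ι ℂ, Q.IsHermitian ∧ Q * Q = Q ∧ Q * X * Q = 0 ∧
      (1 - Q).trace.re = X.rank := by
  obtain ⟨U, h1, h2, hX', -⟩ := exists_diagonalization hX
  have hrank := hX.rank_eq_card_non_zero_eigs
  generalize hX.eigenvalues = l at hX' hrank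
  set E : Matrix ι ι ℂ := Matrix.diagonal fun i => if l i = 0 then 1 else 0 with hE
  have hEh : Eᴴ = E := by
    rw [hE, Matrix.diagonal_conjTranspose]
    congr 1; ext i; simp [apply_ite]
  have hmul : ∀ A B : Matrix ι ι ℂ, U * A * Uᴴ * (U * B * Uᴴ) = U * (A * B) * Uᴴ := fun A B => by
    calc U * A * Uᴴ * (U * B * Uᴴ) = U * A * (Uᴴ * U) * B * Uᴴ := by simp only [Matrix.mul_assoc]
      _ = _ := by rw [h2]; simp only [mul_one, Matrix.mul_assoc]
  refine ⟨U * E * Uᴴ, ?_, ?_, ?_, ?_⟩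
  · rw [Matrix.IsHermitian, Matrix.conjTranspose_mul, Matrix.conjTranspose_mul, hEh,
      Matrix.conjTranspose_conjTranspose, Matrix.mul_assoc]
  · rw [hmul, hE, Matrix.diagonal_mul_diagonal]
    congr 3; ext i; by_cases h : l i = 0 <;> simp [h]
  · have h0 : E * (Matrix.diagonal fun i => (l i : ℂ)) = 0 := by
      rw [hE, Matrix.diagonal_mul_diagonal, ← Matrix.diagonal_zero]
      congr 1; ext i; by_cases h : l i = 0 <;> simp [h]
    rw [hX', hmul, hmul, h0]
    simp
  · rw [Matrix.trace_sub, Matrix.trace_mul_comm, ← Matrix.mul_assoc, h2, one_mul, hE,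
      ← Matrix.diagonal_one, Matrix.trace_diagonal, Matrix.trace_diagonal,
      ← Finset.sum_sub_distrib, hrank, Fintype.card_subtype, Complex.re_sum,
      Finset.card_filter]
    push_cast
    exact Finset.sum_congr rfl fun i _ => by by_cases h : l i = 0 <;> simp [h]

end Exp

/-! ### The random dual certificate -/

section Certificate

variable {ι L : Type*} [Fintype ι]

/-- The state of the construction of a dual certificate from the labels drawn so far: a real
combination `certificate` of the measured matrices, and the part `residual` of the target which its
projection to the tangent space does not yet account for. -/
structure GolfState (ι : Type*) where
  residual : Matrix ι ι ℂ
  certificate : Matrix ι ι ℂ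

/-- The invariant of the construction: `certificate` and `residual` are Hermitian, and `residual`
is tangent. -/
structure GolfState.IsTangent (Q : Matrix ι ι ℂ) (s : GolfState ι) : Prop where
  residual_isHermitian : s.residual.IsHermitian
  certificate_isHermitian : s.certificate.IsHermitian
  conj_residual : Q * s.residual * Q = 0

/-- The squared Hilbert–Schmidt norm of the residual. -/
noncomputable def GolfState.energy (s : GolfState ι) : ℝ := hs s.residual s.residual

/-- One label `a` is drawn: a multiple of `w a`, proportional to its inner product with the
residual, is added to the certificate. For a uniformly random label the added matrix is on average
`γ / d` times the residual. -/
noncomputable def golfStep (w : L → Matrix ι ι ℂ) (Q : Matrix ι ι ℂ) (γ : ℝ) (s : GolfState ι)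
    (a : L) : GolfState ι where
  residual := s.residual - (γ * hs (w a) s.residual) • tangentProj Q (w a)
  certificate := s.certificate + (γ * hs (w a) s.residual) • w a

/-- The start of the construction of a certificate for the tangent matrix `F`. -/
def golfStart (F : Matrix ι ι ℂ) : GolfState ι := ⟨F, 0⟩

variable {w : L → Matrix ι ι ℂ} {Q : Matrix ι ι ℂ} {γ : ℝ} {s : GolfState ι}

lemma GolfState.energy_nonneg (s : GolfState ι) : 0 ≤ s.energy := hs_self_nonneg _

lemma golfStart_isTangent {F : Matrix ι ι ℂ} (hF : F.IsHermitian) (hQF : Q * F * Q = 0) :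
    (golfStart F).IsTangent Q :=
  ⟨hF, Matrix.isHermitian_zero, hQF⟩

lemma residual_add_tangentProj_golfStep (a : L) :
    (golfStep w Q γ s a).residual + tangentProj Q (golfStep w Q γ s a).certificate =
      s.residual + tangentProj Q s.certificate := by
  simp only [golfStep, tangentProj_add, tangentProj_smul]
  abel

lemma residual_add_tangentProj_foldl (l : List L) (s : GolfState ι) :
    (l.foldl (golfStep w Q γ) s).residual +
      tangentProj Q (l.foldl (golfStep w Q γ) s).certificate =
      s.residual + tangentProj Q s.certificate := by
  induction l generalizing s with
  | nil => rfl
  | cons a l ih => rw [List.foldl_cons, ih, residual_add_tangentProj_golfStep]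

lemma hs_certificate_foldl_eq_zero {X : Matrix ι ι ℂ} (l : List L) (s : GolfState ι)
    (hX : ∀ a ∈ l, hs (w a) X = 0) (hs0 : hs s.certificate X = 0) :
    hs (l.foldl (golfStep w Q γ) s).certificate X = 0 := by
  induction l generalizing s with
  | nil => exact hs0
  | cons a l ih =>
    refine ih _ (fun b hb => hX b (List.mem_cons_of_mem _ hb)) ?_
    rw [golfStep, hs_add_left, hs_smul_left, hs0, hX a List.mem_cons_self, mul_zero, add_zero]

variable [DecidableEq ι] [Fintype L] {r : ℝ}

/-- The standing assumptions: `w` is a frame of Hermitian unitaries, `Q` is an orthogonal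
projection, to be thought of as the projection onto the kernel of a matrix of rank `r > 0`, and the
gain `γ` is small enough for the energy to decrease at every step. The rank is a real number. -/
structure IsGolfSetup (w : L → Matrix ι ι ℂ) (Q : Matrix ι ι ℂ) (γ r : ℝ) : Prop where
  frame : IsUnitaryFrame w
  isHermitian : Q.IsHermitian
  mul_self : Q * Q = Q
  trace_eq : (1 - Q).trace.re = r
  rank_pos : 0 < r
  gain_pos : 0 < γ
  gain_le : 2 * γ * r ≤ 1

lemma IsGolfSetup.golfStep_isTangent (h : IsGolfSetup w Q γ r) (hs : s.IsTangent Q) (a : L) :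
    (golfStep w Q γ s a).IsTangent Q where
  residual_isHermitian := hs.residual_isHermitian.sub (real_smul_isHermitian
    (tangentProj_isHermitian h.isHermitian (h.frame.isHermitian a)) _)
  certificate_isHermitian :=
    hs.certificate_isHermitian.add (real_smul_isHermitian (h.frame.isHermitian a) _)
  conj_residual := by
    rw [golfStep, Matrix.mul_sub, Matrix.sub_mul, hs.conj_residual, Matrix.mul_smul,
      Matrix.smul_mul, conj_tangentProj h.mul_self, smul_zero, sub_zero]

/-- The tangent projections of the frame elements are short, so no label dominates. -/
lemma IsGolfSetup.hs_sq_le (h : IsGolfSetup w Q γ r) (hs' : s.IsTangent Q) (a : L) :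
    hs (w a) s.residual ^ 2 ≤ 2 * r * s.energy := by
  rw [← tangentProj_eq_self hs'.conj_residual, ← hs_tangentProj_left h.isHermitian]
  refine (hs_mul_hs_le _ _).trans ?_
  refine mul_le_mul_of_nonneg_right ?_ s.energy_nonneg
  rw [← h.trace_eq]
  exact hs_tangentProj_self_le h.isHermitian h.mul_self (h.frame.isHermitian a) (h.frame.mul_self a)

lemma IsGolfSetup.energy_golfStep_le (h : IsGolfSetup w Q γ r) (hs' : s.IsTangent Q) (a : L) :
    (golfStep w Q γ s a).energy ≤ s.energy - γ * hs (w a) s.residual ^ 2 := by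
  have h1 := hs_tangentProj_self_le h.isHermitian h.mul_self (h.frame.isHermitian a)
    (h.frame.mul_self a)
  rw [h.trace_eq] at h1
  have h2 : hs s.residual (tangentProj Q (w a)) = hs (w a) s.residual := by
    rw [← hs_tangentProj_left h.isHermitian, tangentProj_eq_self hs'.conj_residual, hs_comm]
  simp only [GolfState.energy, golfStep, hs_sub_left, hs_sub_right, hs_smul_left, hs_smul_right,
    hs_comm (tangentProj Q (w a)) s.residual, h2]
  set t := hs (w a) s.residual
  set p := hs (tangentProj Q (w a)) (tangentProj Q (w a))
  have h3 : γ * p ≤ 1 := by nlinarith [h.gain_pos, h.gain_le]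
  nlinarith [mul_nonneg h.gain_pos.le (sq_nonneg t), mul_le_mul_of_nonneg_left h3
    (mul_nonneg h.gain_pos.le (sq_nonneg t))]

lemma IsGolfSetup.foldl_isTangent (h : IsGolfSetup w Q γ r) (l : List L) {s : GolfState ι}
    (hs : s.IsTangent Q) : (l.foldl (golfStep w Q γ) s).IsTangent Q := by
  induction l generalizing s with
  | nil => exact hs
  | cons a l ih => exact ih (h.golfStep_isTangent hs a)

/-- A crude bound for the size of the certificate. -/
lemma IsGolfSetup.abs_hs_certificate_le (h : IsGolfSetup w Q γ r) (l : List L) {s : GolfState ι}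
    (hs' : s.IsTangent Q) (X : Matrix ι ι ℂ) {V : ℝ} (hV : s.energy ≤ V) :
    |hs (l.foldl (golfStep w Q γ) s).certificate X| ≤
      |hs s.certificate X| + l.length * (γ * Fintype.card ι * √V * √(hs X X)) := by
  induction l generalizing s with
  | nil => simp
  | cons a l ih =>
    have hww : hs (w a) (w a) = Fintype.card ι := by
      simp [hs, (h.frame.isHermitian a).eq, h.frame.mul_self a]
    have hcs : ∀ Z, |hs (w a) Z| ≤ √(Fintype.card ι) * √(hs Z Z) := fun Z => by
      rw [← Real.sqrt_mul (Nat.cast_nonneg _)]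
      apply Real.abs_le_sqrt
      rw [← hww]
      exact hs_mul_hs_le _ _
    have hle : (golfStep w Q γ s a).energy ≤ V := by
      have := h.energy_golfStep_le hs' a
      nlinarith [mul_nonneg h.gain_pos.le (sq_nonneg (hs (w a) s.residual))]
    refine (ih (h.golfStep_isTangent hs' a) hle).trans ?_
    have h1 : |hs (golfStep w Q γ s a).certificate X| ≤
        |hs s.certificate X| + γ * Fintype.card ι * √V * √(hs X X) := by
      rw [golfStep, hs_add_left, hs_smul_left]
      refine (abs_add_le _ _).trans (add_le_add le_rfl ?_)
      rw [abs_mul, abs_mul, abs_of_pos h.gain_pos]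
      calc γ * |hs (w a) s.residual| * |hs (w a) X|
          ≤ γ * (√(Fintype.card ι) * √V) * (√(Fintype.card ι) * √(hs X X)) := by
            have := h.gain_pos
            have hb : |hs (w a) s.residual| ≤ √(Fintype.card ι) * √V :=
              (hcs _).trans (by gcongr; exact hV)
            gcongr
            exact hcs X
        _ = γ * (√(Fintype.card ι) * √(Fintype.card ι)) * √V * √(hs X X) := by ring
        _ = _ := by rw [Real.mul_self_sqrt (Nat.cast_nonneg _)]
    rw [List.length_cons]
    push_cast
    linarith

end Certificate

/-! ### Tail bounds -/

section Tail

/-- The supermartingale property, for a Markov chain driven by independent uniform labels. -/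
lemma sum_foldl_ofFn_le {S L : Type*} [Fintype L] (step : S → L → S) (Inv : S → Prop)
    (hInv : ∀ s, Inv s → ∀ a, Inv (step s a)) (Φ : S → ℝ) {q : ℝ} (hq : 0 ≤ q)
    (hΦ : ∀ s, Inv s → ∑ a, Φ (step s a) ≤ q * Φ s) (m : ℕ) {s : S} (hs : Inv s) :
    ∑ A : Fin m → L, Φ ((List.ofFn A).foldl step s) ≤ q ^ m * Φ s := by
  induction m generalizing s with
  | zero => simp
  | succ m ih =>
    rw [← (Fin.consEquiv fun _ => L).sum_comp, Fintype.sum_prod_type]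
    simp only [Fin.consEquiv, Equiv.coe_fn_mk, List.ofFn_cons, List.foldl_cons]
    calc ∑ a, ∑ A : Fin m → L, Φ ((List.ofFn A).foldl step (step s a))
        ≤ ∑ a, q ^ m * Φ (step s a) := Finset.sum_le_sum fun a _ => ih (hInv s hs a)
      _ = q ^ m * ∑ a, Φ (step s a) := by rw [Finset.mul_sum]
      _ ≤ q ^ m * (q * Φ s) := by gcongr; exact hΦ s hs
      _ = _ := by ring

lemma card_filter_mul_le_sum {T : Type*} [Fintype T] (p : T → Prop) [DecidablePred p]
    (f : T → ℝ) {c : ℝ}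
    (hf : ∀ x, 0 ≤ f x) (hp : ∀ x, p x → c ≤ f x) :
    (Finset.univ.filter p).card * c ≤ ∑ x, f x := by
  calc ((Finset.univ.filter p).card : ℝ) * c = ∑ x ∈ Finset.univ.filter p, c := by simp
    _ ≤ ∑ x ∈ Finset.univ.filter p, f x :=
      Finset.sum_le_sum fun x hx => hp x (Finset.mem_filter.1 hx).2
    _ ≤ _ := Finset.sum_le_sum_of_subset_of_nonneg (Finset.filter_subset _ _) fun x _ _ => hf x

variable {ι L : Type*} [Fintype ι] [DecidableEq ι] [Fintype L]
  {w : L → Matrix ι ι ℂ} {Q : Matrix ι ι ℂ} {γ r : ℝ}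

lemma IsGolfSetup.card_pos (h : IsGolfSetup w Q γ r) : 0 < Fintype.card ι := by
  rw [Fintype.card_pos_iff]
  by_contra hne
  rw [not_nonempty_iff] at hne
  have := h.trace_eq
  simp [Matrix.trace] at this
  linarith [h.rank_pos]

/-- A power of the energy decreases exponentially on average. The exponent is the largest one for
which the decrease in one step is bounded. -/
lemma IsGolfSetup.sum_energy_rpow_le (h : IsGolfSetup w Q γ r) {s : GolfState ι}
    (hs' : s.IsTangent Q) :
    ∑ a, (golfStep w Q γ s a).energy ^ (2 * r * γ)⁻¹ ≤
      (Fintype.card ι ^ 2 * Real.exp (-(4 * r * Fintype.card ι)⁻¹)) *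
        s.energy ^ (2 * r * γ)⁻¹ := by
  have hr := h.rank_pos
  have hγ := h.gain_pos
  have hd : (0 : ℝ) < Fintype.card ι := by exact_mod_cast h.card_pos
  have he : (0 : ℝ) < (2 * r * γ)⁻¹ := by positivity
  have hdec : ∀ a, (golfStep w Q γ s a).energy ≤ s.energy := fun a => by
    have := h.energy_golfStep_le hs' a
    nlinarith [mul_nonneg h.gain_pos.le (sq_nonneg (hs (w a) s.residual))]
  rcases s.energy_nonneg.eq_or_lt with h0 | h0
  · have : ∀ a, (golfStep w Q γ s a).energy = 0 := fun a =>
      le_antisymm (h0 ▸ hdec a) (GolfState.energy_nonneg _)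
    simp only [this, ← h0, Real.zero_rpow he.ne', mul_zero, Finset.sum_const_zero, le_refl]
  set W := s.energy with hW
  set z : L → ℝ := fun a => hs (w a) s.residual ^ 2 / (2 * r * W) with hz
  have hz0 : ∀ a, 0 ≤ z a := fun a => by positivity
  have hz1 : ∀ a, z a ≤ 1 := fun a => by
    rw [hz, div_le_one (by positivity)]
    exact h.hs_sq_le hs' a
  have hsum : ∑ a, z a = Fintype.card ι / (2 * r) := by
    rw [← Finset.sum_div, h.frame.sum_hs_sq hs'.residual_isHermitian]
    change (Fintype.card ι * W) / (2 * r * W) = _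
    field_simp
  have hstep : ∀ a, (golfStep w Q γ s a).energy ^ (2 * r * γ)⁻¹ ≤
      W ^ (2 * r * γ)⁻¹ * (1 - z a / 2) := fun a => by
    have h1 : (golfStep w Q γ s a).energy ≤ W * Real.exp (-(2 * r * γ * z a)) := by
      refine (h.energy_golfStep_le hs' a).trans ?_
      have h2 : γ * hs (w a) s.residual ^ 2 = W * (2 * r * γ * z a) := by
        rw [hz]; field_simp
      rw [h2]
      nlinarith [Real.add_one_le_exp (-(2 * r * γ * z a))]
    calc (golfStep w Q γ s a).energy ^ (2 * r * γ)⁻¹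
        ≤ (W * Real.exp (-(2 * r * γ * z a))) ^ (2 * r * γ)⁻¹ :=
          Real.rpow_le_rpow (GolfState.energy_nonneg _) h1 he.le
      _ = W ^ (2 * r * γ)⁻¹ * Real.exp (-z a) := by
          rw [Real.mul_rpow h0.le (Real.exp_pos _).le, ← Real.exp_mul]
          congr 2
          field_simp
      _ ≤ _ := by
          refine mul_le_mul_of_nonneg_left ?_ (by positivity)
          rw [Real.exp_neg, inv_le_comm₀ (Real.exp_pos _) (by linarith [hz1 a])]
          refine le_trans ?_ (Real.add_one_le_exp (z a))
          rw [inv_eq_one_div, div_le_iff₀ (by linarith [hz1 a])]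
          nlinarith [hz0 a, hz1 a]
  calc ∑ a, (golfStep w Q γ s a).energy ^ (2 * r * γ)⁻¹
      ≤ ∑ a, W ^ (2 * r * γ)⁻¹ * (1 - z a / 2) := Finset.sum_le_sum fun a _ => hstep a
    _ = W ^ (2 * r * γ)⁻¹ * (Fintype.card ι ^ 2 * (1 - (4 * r * Fintype.card ι)⁻¹)) := by
        rw [← Finset.mul_sum, Finset.sum_sub_distrib, ← Finset.sum_div, hsum, Finset.sum_const,
          Finset.card_univ, h.frame.card_eq]
        congr 1
        simp
        field_simp
        ring
    _ ≤ W ^ (2 * r * γ)⁻¹ * (Fintype.card ι ^ 2 * Real.exp (-(4 * r * Fintype.card ι)⁻¹)) := by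
        gcongr
        linarith [Real.add_one_le_exp (-(4 * r * Fintype.card ι : ℝ)⁻¹)]
    _ = _ := by ring

open Classical in
/-- Markov's inequality for the power of the energy in `sum_energy_rpow_le`. -/
lemma IsGolfSetup.card_energy_gt_le (h : IsGolfSetup w Q γ r) {s : GolfState ι}
    (hs' : s.IsTangent Q) {V : ℝ} (hV : 0 < V) (hsV : s.energy ≤ V) (m : ℕ) (x : ℝ) :
    ((Finset.univ.filter fun A : Fin m → L =>
      Real.exp (-x) * V < ((List.ofFn A).foldl (golfStep w Q γ) s).energy).card : ℝ) ≤
      (Fintype.card ι ^ 2) ^ m *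
        Real.exp ((2 * r * γ)⁻¹ * x - m * (4 * r * Fintype.card ι)⁻¹) := by
  have hr := h.rank_pos
  have hγ := h.gain_pos
  have he : (0 : ℝ) < (2 * r * γ)⁻¹ := by positivity
  have h1 := sum_foldl_ofFn_le (golfStep w Q γ) (GolfState.IsTangent Q)
    (fun s hs a => h.golfStep_isTangent hs a) (fun s => s.energy ^ (2 * r * γ)⁻¹) (by positivity)
    (fun s hs => h.sum_energy_rpow_le hs) m hs'
  have h2 := card_filter_mul_le_sum (fun A : Fin m → L =>
      Real.exp (-x) * V < ((List.ofFn A).foldl (golfStep w Q γ) s).energy)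
      (fun A => ((List.ofFn A).foldl (golfStep w Q γ) s).energy ^ (2 * r * γ)⁻¹)
      (c := (Real.exp (-x) * V) ^ (2 * r * γ)⁻¹)
      (fun A => Real.rpow_nonneg (GolfState.energy_nonneg _) _)
      (fun A hA => Real.rpow_le_rpow (by positivity) hA.le he.le)
  have h3 : s.energy ^ (2 * r * γ)⁻¹ ≤ V ^ (2 * r * γ)⁻¹ :=
    Real.rpow_le_rpow s.energy_nonneg hsV he.le
  have hVp : 0 < V ^ (2 * r * γ)⁻¹ := by positivity
  rw [Real.mul_rpow (Real.exp_pos _).le hV.le, ← Real.exp_mul] at h2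
  rw [mul_pow, ← Real.exp_nat_mul] at h1
  refine le_of_mul_le_mul_right ?_
    (show 0 < Real.exp (-x * (2 * r * γ)⁻¹) * V ^ (2 * r * γ)⁻¹ by positivity)
  refine (h2.trans h1).trans ((mul_le_mul_of_nonneg_left h3 (by positivity)).trans_eq ?_)
  rw [sub_eq_add_neg, Real.exp_add]
  have h4 : Real.exp ((2 * r * γ)⁻¹ * x) * Real.exp (-x * (2 * r * γ)⁻¹) = 1 := by
    rw [← Real.exp_add, Real.exp_eq_one_iff]; ring
  have h5 : (m : ℝ) * -(4 * r * Fintype.card ι)⁻¹ = -(m * (4 * r * Fintype.card ι)⁻¹) := by ring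
  rw [h5]
  linear_combination -((Fintype.card ι ^ 2 : ℝ) ^ m *
    Real.exp (-(m * (4 * r * Fintype.card ι : ℝ)⁻¹)) * V ^ (2 * r * γ)⁻¹) * h4

open NormedSpace in
/-- The matrix exponential moment of the compressed certificate is controlled by the energy that is
spent: the factor `exp (-b ^ 2)` gained from the loss of energy in one step pays for the quadratic
term of the exponential of the increment, whose linear term vanishes on average. -/
lemma IsGolfSetup.sum_trace_exp_le (h : IsGolfSetup w Q γ r) {s : GolfState ι}
    (hs' : s.IsTangent Q) {θ : ℝ} (hθ : 8 * θ ^ 2 * γ ^ 2 * r * s.energy ≤ 1) :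
    ∑ a, Real.exp (θ ^ 2 * γ * (golfStep w Q γ s a).energy) *
        (exp (θ • (Q * (golfStep w Q γ s a).certificate * Q))).trace.re ≤
      Fintype.card ι ^ 2 * (Real.exp (θ ^ 2 * γ * s.energy) *
        (exp (θ • (Q * s.certificate * Q))).trace.re) := by
  have hQY : ∀ {Y : Matrix ι ι ℂ}, Y.IsHermitian → (Q * Y * Q).IsHermitian := fun {Y} hY => by
    have := Matrix.isHermitian_mul_mul_conjTranspose Q hY
    rwa [h.isHermitian.eq] at this
  set H := θ • (Q * s.certificate * Q) with hH
  have hHh : H.IsHermitian := real_smul_isHermitian (hQY hs'.certificate_isHermitian) _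
  set t : L → ℝ := fun a => hs (w a) s.residual with ht
  set X : L → Matrix ι ι ℂ := fun a => (θ * γ * t a) • (Q * w a * Q) with hX
  have hXh : ∀ a, (X a).IsHermitian := fun a =>
    real_smul_isHermitian (hQY (h.frame.isHermitian a)) _
  have hnext : ∀ a, θ • (Q * (golfStep w Q γ s a).certificate * Q) = H + X a := fun a => by
    simp only [golfStep, Matrix.mul_add, Matrix.add_mul, smul_add, Matrix.mul_smul,
      Matrix.smul_mul, smul_smul, hH, hX, ht, mul_assoc]
  have hE : (exp H).PosSemidef := exp_posSemidef hHh
  have hterm : ∀ a, Real.exp (θ ^ 2 * γ * (golfStep w Q γ s a).energy) *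
        (exp (θ • (Q * (golfStep w Q γ s a).certificate * Q))).trace.re ≤
      Real.exp (θ ^ 2 * γ * s.energy) * (exp H * (1 + X a)).trace.re := fun a => by
    set b := θ * γ * t a with hb
    have hb1 : b ^ 2 ≤ 1 / 4 := by
      have h1 := h.hs_sq_le hs' a
      have h2 : b ^ 2 = θ ^ 2 * γ ^ 2 * t a ^ 2 := by rw [hb]; ring
      rw [h2]
      nlinarith [mul_le_mul_of_nonneg_left h1 (by positivity : 0 ≤ θ ^ 2 * γ ^ 2)]
    have hexp : Real.exp (θ ^ 2 * γ * (golfStep w Q γ s a).energy) ≤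
        Real.exp (θ ^ 2 * γ * s.energy) * Real.exp (-b ^ 2) := by
      rw [← Real.exp_add, Real.exp_le_exp]
      have h1 := h.energy_golfStep_le hs' a
      have h2 : b ^ 2 = θ ^ 2 * γ * (γ * hs (w a) s.residual ^ 2) := by rw [hb, ht]; ring
      nlinarith [mul_le_mul_of_nonneg_left h1 (mul_nonneg (sq_nonneg θ) h.gain_pos.le)]
    have hXb : ((b ^ 2) • (1 : Matrix ι ι ℂ) - X a * X a).PosSemidef := by
      have h1 := (conj_mul_conj_le_one h.isHermitian h.mul_self (h.frame.isHermitian a)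
        (h.frame.mul_self a)).smul (sq_nonneg b)
      convert h1 using 1
      simp only [hX, Matrix.smul_mul, Matrix.mul_smul, smul_smul, smul_sub, pow_two, hb]
    have hGT : (exp (H + X a)).trace.re ≤ (exp H * exp (X a)).trace.re :=
      trace_exp_add_le hHh (hXh a)
    have h3 := trace_mul_nonneg hE (one_add_sub_exp_posSemidef (hXh a) hXb hb1)
    rw [Matrix.mul_sub, Matrix.trace_sub, Complex.sub_re, Matrix.mul_smul, Matrix.trace_smul,
      Complex.smul_re, smul_eq_mul] at h3
    rw [hnext]
    have h4 : 0 ≤ (exp (H + X a)).trace.re :=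
      (Complex.le_def.1 (exp_posSemidef (hHh.add (hXh a))).trace_nonneg).1
    calc _ ≤ (Real.exp (θ ^ 2 * γ * s.energy) * Real.exp (-b ^ 2)) *
          (exp (H + X a)).trace.re := by gcongr
      _ ≤ (Real.exp (θ ^ 2 * γ * s.energy) * Real.exp (-b ^ 2)) *
          (exp H * exp (X a)).trace.re := by gcongr
      _ = Real.exp (θ ^ 2 * γ * s.energy) *
          (Real.exp (-b ^ 2) * (exp H * exp (X a)).trace.re) := by ring
      _ ≤ _ := by gcongr; linarith
  refine (Finset.sum_le_sum fun a _ => hterm a).trans_eq ?_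
  -- on average the increment is a multiple of the residual, whose compression vanishes
  have hmean : ∑ a, X a = 0 := by
    have h1 : ∑ a, X a = (θ * γ) • (Q * (∑ a, t a • w a) * Q) := by
      rw [Matrix.mul_sum, Matrix.sum_mul, Finset.smul_sum]
      exact Finset.sum_congr rfl fun a _ => by
        simp only [hX, Matrix.mul_smul, Matrix.smul_mul, smul_smul]
    rw [h1, h.frame.sum_hs_smul _ hs'.residual_isHermitian, Matrix.mul_smul, Matrix.smul_mul,
      hs'.conj_residual, smul_zero, smul_zero]
  have hsum : ∑ a, (exp H * (1 + X a)).trace.re = Fintype.card ι ^ 2 * (exp H).trace.re := by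
    rw [← Complex.re_sum, ← Matrix.trace_sum, ← Matrix.mul_sum, Finset.sum_add_distrib, hmean,
      add_zero, Finset.sum_const, Finset.card_univ, h.frame.card_eq, ← Nat.cast_smul_eq_nsmul ℝ,
      Matrix.mul_smul, mul_one, Matrix.trace_smul, Complex.smul_re, smul_eq_mul, Nat.cast_pow]
  rw [← Finset.mul_sum, hsum]
  ring

open Classical in
/-- Markov's inequality for the matrix exponential moment in `sum_trace_exp_le`. Only an upper bound
for the compressed certificate is needed, and only that is provided. -/
lemma IsGolfSetup.card_certificate_le (h : IsGolfSetup w Q γ r) {F : Matrix ι ι ℂ}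
    (hs' : (golfStart F).IsTangent Q) {θ V : ℝ} (hθ0 : 0 ≤ θ) (hV : hs F F ≤ V)
    (hθ : 8 * θ ^ 2 * γ ^ 2 * r * V ≤ 1) (m : ℕ) (x : ℝ) :
    ((Finset.univ.filter fun A : Fin m → L => ¬ (x • (1 : Matrix ι ι ℂ) -
        Q * ((List.ofFn A).foldl (golfStep w Q γ) (golfStart F)).certificate * Q).PosSemidef).card
        : ℝ) ≤
      (Fintype.card ι ^ 2) ^ m * (Fintype.card ι * Real.exp (θ ^ 2 * γ * V - θ * x)) := by
  have hr := h.rank_pos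
  have hγ := h.gain_pos
  have hQY : ∀ {Y : Matrix ι ι ℂ}, Y.IsHermitian → (Q * Y * Q).IsHermitian := fun {Y} hY => by
    have := Matrix.isHermitian_mul_mul_conjTranspose Q hY
    rwa [h.isHermitian.eq] at this
  have h1 := sum_foldl_ofFn_le (golfStep w Q γ) (fun s => s.IsTangent Q ∧ s.energy ≤ V)
    (fun s hs a => ⟨h.golfStep_isTangent hs.1 a, by
      have := h.energy_golfStep_le hs.1 a
      nlinarith [mul_nonneg h.gain_pos.le (sq_nonneg (PauliTomography.hs (w a) s.residual)), hs.2]⟩)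
    (fun s => Real.exp (θ ^ 2 * γ * s.energy) *
        (NormedSpace.exp (θ • (Q * s.certificate * Q))).trace.re)
    (q := Fintype.card ι ^ 2) (by positivity)
    (fun s hs => h.sum_trace_exp_le hs.1 (le_trans (by
      refine mul_le_mul_of_nonneg_left hs.2 (by positivity)) hθ)) m (s := golfStart F) ⟨hs', hV⟩
  have h2 := card_filter_mul_le_sum (fun A : Fin m → L => ¬ (x • (1 : Matrix ι ι ℂ) -
        Q * ((List.ofFn A).foldl (golfStep w Q γ) (golfStart F)).certificate * Q).PosSemidef)
      (fun A => Real.exp (θ ^ 2 * γ * ((List.ofFn A).foldl (golfStep w Q γ) (golfStart F)).energy) *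
        (NormedSpace.exp (θ • (Q * ((List.ofFn A).foldl (golfStep w Q γ)
          (golfStart F)).certificate * Q))).trace.re)
      (c := Real.exp (θ * x))
      (fun A => mul_nonneg (Real.exp_pos _).le (Complex.le_def.1 (exp_posSemidef
        (real_smul_isHermitian (hQY (h.foldl_isTangent _ hs').certificate_isHermitian)
          _)).trace_nonneg).1)
      (fun A hA => by
        have h3 := exp_le_trace_exp (hQY (h.foldl_isTangent _ hs').certificate_isHermitian) hθ0 hA
        have h4 : 1 ≤ Real.exp (θ ^ 2 * γ *
            ((List.ofFn A).foldl (golfStep w Q γ) (golfStart F)).energy) :=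
          Real.one_le_exp (mul_nonneg (by positivity) (GolfState.energy_nonneg _))
        nlinarith [Real.exp_pos (θ * x)])
  have h5 : (NormedSpace.exp (θ • (Q * (golfStart F).certificate * Q))).trace.re =
      Fintype.card ι := by
    simp [golfStart]
  rw [h5] at h1
  have h6 : Real.exp (θ ^ 2 * γ * (golfStart F).energy) ≤ Real.exp (θ ^ 2 * γ * V) := by
    rw [Real.exp_le_exp]
    exact mul_le_mul_of_nonneg_left hV (by positivity)
  refine le_of_mul_le_mul_right ((h2.trans h1).trans ?_) (Real.exp_pos (θ * x))
  have h7 : Real.exp (θ ^ 2 * γ * V - θ * x) * Real.exp (θ * x) = Real.exp (θ ^ 2 * γ * V) := by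
    rw [← Real.exp_add, sub_add_cancel]
  calc _ ≤ ((Fintype.card ι : ℝ) ^ 2) ^ m * (Real.exp (θ ^ 2 * γ * V) * Fintype.card ι) := by gcongr
    _ = _ := by rw [← h7]; ring

end Tail

/-! ### From certificates to uniqueness -/

section Uniqueness

variable {ι L : Type*} [Fintype ι] [DecidableEq ι] [Fintype L]
  {w : L → Matrix ι ι ℂ} {Q : Matrix ι ι ℂ} {γ r : ℝ}

/-- Approximate certificates for the tangent parts of all frame elements, with residual energy at
most `δ`, show that a matrix which the measured frame elements do not see is not much larger on the
tangent space than off it. -/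
lemma IsGolfSetup.hs_tangentProj_le (h : IsGolfSetup w Q γ r) {δ V : ℝ} {l : List L}
    (hV : 2 * r ≤ V) (hδ : 4 * Fintype.card ι * δ ≤ 1)
    (hl : ∀ b, (l.foldl (golfStep w Q γ) (golfStart (tangentProj Q (w b)))).energy ≤ δ)
    {Δ : Matrix ι ι ℂ} (hΔ : Δ.IsHermitian) (hA : ∀ a ∈ l, hs (w a) Δ = 0) :
    hs (tangentProj Q Δ) (tangentProj Q Δ) ≤
      4 * Fintype.card ι * (l.length * γ * Fintype.card ι) ^ 2 * V *
        hs (Q * Δ * Q) (Q * Δ * Q) := by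
  set T := hs (tangentProj Q Δ) (tangentProj Q Δ) with hT
  set E := hs (Q * Δ * Q) (Q * Δ * Q) with hE
  have hT0 : 0 ≤ T := hs_self_nonneg _
  have hE0 : 0 ≤ E := hs_self_nonneg _
  have hr := h.rank_pos
  have hV0 : 0 ≤ V := by linarith
  have hd : (0 : ℝ) < Fintype.card ι := by exact_mod_cast h.card_pos
  have hb : ∀ b, hs (w b) (tangentProj Q Δ) ^ 2 ≤
      2 * δ * T + 2 * (l.length * γ * Fintype.card ι) ^ 2 * V * E := fun b => by
    set s := golfStart (tangentProj Q (w b)) with hs0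
    have hs' : s.IsTangent Q := golfStart_isTangent
      (tangentProj_isHermitian h.isHermitian (h.frame.isHermitian b))
      (conj_tangentProj h.mul_self _)
    set f := l.foldl (golfStep w Q γ) s with hf
    have hft : f.IsTangent Q := h.foldl_isTangent l hs'
    have e1 : f.residual + tangentProj Q f.certificate = tangentProj Q (w b) := by
      rw [hf, residual_add_tangentProj_foldl]
      simp [hs0, golfStart, tangentProj]
    have e2 : hs f.certificate Δ = 0 :=
      hs_certificate_foldl_eq_zero l s hA (by simp [hs0, golfStart, hs])
    have e3 : hs (w b) (tangentProj Q Δ) =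
        hs f.residual (tangentProj Q Δ) - hs f.certificate (Q * Δ * Q) := by
      rw [← hs_tangentProj_left h.isHermitian, ← e1, hs_add_left,
        hs_tangentProj_left h.isHermitian f.certificate,
        ← hs_tangentProj_left h.isHermitian f.residual, tangentProj_eq_self hft.conj_residual,
        tangentProj, hs_sub_right, e2]
      ring
    have e4 : hs f.residual (tangentProj Q Δ) ^ 2 ≤ δ * T :=
      (hs_mul_hs_le _ _).trans (mul_le_mul_of_nonneg_right (hl b) hT0)
    have e5 : hs f.certificate (Q * Δ * Q) ^ 2 ≤ (l.length * γ * Fintype.card ι) ^ 2 * V * E := by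
      have hsV : s.energy ≤ V := by
        refine le_trans ?_ hV
        rw [← h.trace_eq]
        exact hs_tangentProj_self_le h.isHermitian h.mul_self (h.frame.isHermitian b)
          (h.frame.mul_self b)
      have h1 := h.abs_hs_certificate_le l hs' (Q * Δ * Q) hsV
      have h2 : hs s.certificate (Q * Δ * Q) = 0 := by simp [hs0, golfStart, hs]
      rw [h2, abs_zero, zero_add] at h1
      rw [← sq_abs]
      refine (pow_le_pow_left₀ (abs_nonneg _) h1 2).trans_eq ?_
      rw [mul_pow, mul_pow, mul_pow, Real.sq_sqrt hV0, Real.sq_sqrt hE0]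
      ring
    rw [e3]
    nlinarith [sq_nonneg (hs f.residual (tangentProj Q Δ) + hs f.certificate (Q * Δ * Q))]
  have hsum := h.frame.sum_hs_sq (tangentProj_isHermitian h.isHermitian hΔ)
  have hle := Finset.sum_le_sum fun b (_ : b ∈ Finset.univ) => hb b
  rw [hsum, Finset.sum_const, Finset.card_univ, h.frame.card_eq, nsmul_eq_mul, ← hT] at hle
  push_cast at hle
  have hle2 : T ≤ Fintype.card ι * (2 * δ * T + 2 * (l.length * γ * Fintype.card ι) ^ 2 * V * E) :=
    le_of_mul_le_mul_left (hle.trans_eq (by ring)) hd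
  nlinarith [mul_le_mul_of_nonneg_right hδ hT0]

/-- The duality argument. The certificate for the projection `1 - Q` is nearly `1 - Q` on the
tangent space and at most `1 / 2` off it; its difference with the identity thus separates `Δ` from
zero. -/
lemma IsGolfSetup.eq_zero (h : IsGolfSetup w Q γ r) {δ V : ℝ} {l : List L}
    (hV : 2 * r ≤ V) (hδ : 4 * Fintype.card ι * δ ≤ 1)
    (hδ' : 16 * Fintype.card ι * (l.length * γ * Fintype.card ι) ^ 2 * V * δ < 1)
    (hl : ∀ b, (l.foldl (golfStep w Q γ) (golfStart (tangentProj Q (w b)))).energy ≤ δ)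
    (hl1 : (l.foldl (golfStep w Q γ) (golfStart (1 - Q))).energy ≤ δ)
    (hY : ((1 / 2 : ℝ) • (1 : Matrix ι ι ℂ) -
      Q * (l.foldl (golfStep w Q γ) (golfStart (1 - Q))).certificate * Q).PosSemidef)
    {Δ : Matrix ι ι ℂ} (hΔ : Δ.IsHermitian) (hΔQ : (Q * Δ * Q).PosSemidef) (htr : Δ.trace = 0)
    (hA : ∀ a ∈ l, hs (w a) Δ = 0) : Δ = 0 := by
  have hTE := h.hs_tangentProj_le hV hδ hl hΔ hA
  set T := hs (tangentProj Q Δ) (tangentProj Q Δ) with hT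
  set E := hs (Q * Δ * Q) (Q * Δ * Q) with hE
  have hT0 : 0 ≤ T := hs_self_nonneg _
  have hED : E ≤ (Q * Δ * Q).trace.re ^ 2 := hs_self_le_trace_sq hΔQ
  set x := (Q * Δ * Q).trace.re with hx
  have hx0 : 0 ≤ x := (Complex.le_def.1 hΔQ.trace_nonneg).1
  have hδ0 : 0 ≤ δ := (GolfState.energy_nonneg _).trans hl1
  have hV0 : 0 ≤ V := by linarith [h.rank_pos]
  have hs' : (golfStart (1 - Q)).IsTangent Q := golfStart_isTangent
    (Matrix.isHermitian_one.sub h.isHermitian) (by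
      rw [Matrix.mul_sub, Matrix.sub_mul, mul_one, h.mul_self, h.mul_self, sub_self])
  set f := l.foldl (golfStep w Q γ) (golfStart (1 - Q)) with hf
  have hft : f.IsTangent Q := h.foldl_isTangent l hs'
  have e1 : f.residual + tangentProj Q f.certificate = 1 - Q := by
    rw [hf, residual_add_tangentProj_foldl]
    simp [golfStart, tangentProj]
  have e2 : hs f.certificate Δ = 0 :=
    hs_certificate_foldl_eq_zero l _ hA (by simp [golfStart, hs])
  have hQt : hs (1 - Q) Δ = -x := by
    rw [hs_sub_left, hs, hs, Matrix.conjTranspose_one, one_mul, htr, h.isHermitian.eq, hx,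
      Matrix.trace_mul_comm (Q * Δ) Q, ← Matrix.mul_assoc, h.mul_self]
    simp
  have e3 : hs f.residual (tangentProj Q Δ) = -x + hs (Q * f.certificate * Q) (Q * Δ * Q) := by
    rw [← hs_tangentProj_left h.isHermitian, tangentProj_eq_self hft.conj_residual, ← hQt, ← e1,
      hs_add_left, tangentProj, hs_sub_left, e2, hs_conj _ _ h.isHermitian,
      hs_conj _ _ h.isHermitian, conj_conj_eq h.mul_self]
    ring
  have e4 : hs (Q * f.certificate * Q) (Q * Δ * Q) ≤ x / 2 := by
    have h1 := trace_mul_nonneg hY hΔQ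
    have hYh : (Q * f.certificate * Q).IsHermitian := by
      have := Matrix.isHermitian_mul_mul_conjTranspose Q hft.certificate_isHermitian
      rwa [h.isHermitian.eq] at this
    rw [Matrix.sub_mul, Matrix.smul_mul, one_mul, Matrix.trace_sub, Matrix.trace_smul,
      Complex.sub_re, Complex.smul_re, smul_eq_mul, ← hx] at h1
    rw [hs, hYh.eq]
    linarith
  have e5 : hs f.residual (tangentProj Q Δ) ^ 2 ≤ δ * T :=
    (hs_mul_hs_le _ _).trans (mul_le_mul_of_nonneg_right hl1 hT0)
  have e6 : (x / 2) ^ 2 ≤ δ * T := by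
    refine le_trans ?_ e5
    rw [e3]
    nlinarith
  set B := 4 * Fintype.card ι * (l.length * γ * Fintype.card ι) ^ 2 * V with hB
  have hB0 : 0 ≤ B := by positivity
  have e7 : δ * T ≤ δ * (B * x ^ 2) := by
    refine mul_le_mul_of_nonneg_left (hTE.trans ?_) hδ0
    exact mul_le_mul_of_nonneg_left hED hB0
  have e8 : 4 * (δ * B) < 1 := by rw [hB]; linarith
  have hx2 : x = 0 := by
    by_contra hne
    have : 0 < x ^ 2 := by positivity
    nlinarith
  have hD : Q * Δ * Q = 0 := by
    rw [← hΔQ.trace_eq_zero_iff]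
    have h1 := Complex.le_def.1 hΔQ.trace_nonneg
    exact Complex.ext hx2 h1.2.symm
  have hEz : E = 0 := by rw [hE, hD]; simp [hs]
  rw [hEz, mul_zero] at hTE
  have hTz := hs_self_eq_zero hTE
  rwa [tangentProj_eq_self hD] at hTz

end Uniqueness

/-! ### The failure probability -/

section Count

variable {ι L : Type*} [Fintype ι] [DecidableEq ι] [Fintype L]
  {w : L → Matrix ι ι ℂ} {Q : Matrix ι ι ℂ} {r : ℝ}

/-- The numerical part of the union bound: `d ^ 2 + 1` residuals and one certificate. -/
lemma failure_sum_le {d c l : ℝ} (hd : Real.exp l = d) (hl : 1 / 2 ≤ l) (hc : 7680 ≤ c) :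
    (d ^ 2 + 1) * Real.exp (-(c * l ^ 2 / 8)) + d * Real.exp (-(c * l / 1920)) ≤
      4 * Real.exp (-(c / 7680)) := by
  have h1 : Real.exp (-(c * l ^ 2 / 8)) ≤ Real.exp (-(c * l / 1920)) := by
    rw [Real.exp_le_exp]
    nlinarith [mul_le_mul_of_nonneg_left hl (by positivity : 0 ≤ c * l), 
      mul_pos (by linarith : 0 < c) (by linarith : 0 < l)]
  have hd1 : 1 ≤ d := hd ▸ Real.one_le_exp (by linarith)
  have h2 : Real.exp (-(c * l / 1920)) * d ^ 2 ≤ Real.exp (-(c / 7680)) := by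
    rw [← hd, ← Real.exp_nat_mul, ← Real.exp_add, Real.exp_le_exp]
    push_cast
    nlinarith [mul_le_mul_of_nonneg_left hl (by linarith : 0 ≤ c),
      mul_le_mul_of_nonneg_right hc (by linarith : 0 ≤ l)]
  have h3 := Real.exp_pos (-(c * l / 1920))
  have h4 : (d ^ 2 + 1) * Real.exp (-(c * l ^ 2 / 8)) ≤
      (d ^ 2 + 1) * Real.exp (-(c * l / 1920)) := by
    gcongr
  nlinarith [mul_le_mul_of_nonneg_left (show d ^ 2 + 1 + d ≤ 4 * d ^ 2 by nlinarith) h3.le]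

open Classical in
/-- Recovery fails for few sequences of labels. The gain is such that `m` steps shrink the energy
by a factor `d ^ (-120)` on average, and by a factor `d ^ (-30)` with high
probability. -/
theorem card_not_unique_le (hw : IsUnitaryFrame w) (hQ : Q.IsHermitian) (hQQ : Q * Q = Q)
    (htr : (1 - Q).trace.re = r) (hr : 1 ≤ r) (hd : 2 ≤ Fintype.card ι) {c : ℝ} (hc : 7680 ≤ c)
    {m : ℕ} (hm : c * Fintype.card ι * r * Real.log (Fintype.card ι) ^ 2 ≤ m) :
    ((Finset.univ.filter fun A : Fin m → L => ¬ ∀ Δ : Matrix ι ι ℂ, Δ.IsHermitian →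
        (Q * Δ * Q).PosSemidef → Δ.trace = 0 → (∀ i, hs (w (A i)) Δ = 0) → Δ = 0).card : ℝ) ≤
      (Fintype.card ι ^ 2) ^ m * (4 * Real.exp (-(c / 7680))) := by
  set d : ℝ := (Fintype.card ι : ℝ) with hd'
  have hd2 : (2 : ℝ) ≤ d := by rw [hd']; exact_mod_cast hd
  have hd0 : 0 < d := by linarith
  set ℓ := Real.log d with hℓ
  have hexp : Real.exp ℓ = d := Real.exp_log hd0
  have hℓ1 : 1 / 2 ≤ ℓ := by
    have h1 := Real.log_two_gt_d9
    have h2 := Real.log_le_log (by norm_num) hd2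
    linarith
  have hℓ0 : 0 < ℓ := by linarith
  have hℓd : ℓ ≤ d := (Real.log_le_sub_one_of_pos hd0).trans (by linarith)
  have hr0 : 0 < r := by linarith
  have hc0 : 0 < c := by linarith
  have hm0 : (0 : ℝ) < m := lt_of_lt_of_le (by positivity) hm
  set γ := 120 * ℓ * d / m with hγ
  have hγ0 : 0 < γ := by positivity
  have hγr : γ * r * (c * ℓ) ≤ 120 := by
    rw [hγ, div_mul_eq_mul_div, div_mul_eq_mul_div, div_le_iff₀ hm0]
    nlinarith
  have hγr' : 2 * γ * r ≤ 1 := by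
    have : 3840 ≤ c * ℓ := by nlinarith
    nlinarith [mul_le_mul_of_nonneg_left this (by positivity : 0 ≤ γ * r)]
  have h : IsGolfSetup w Q γ r := ⟨hw, hQ, hQQ, htr, hr0, hγ0, hγr'⟩
  have hrd : r ≤ d := by
    have h1 : hs Q Q = d - r := by
      rw [hs, hQ.eq, hQQ, ← htr, Matrix.trace_sub, Matrix.trace_one]
      simp [hd']
    linarith [hs_self_nonneg Q]
  have hst1 : (golfStart (1 - Q)).IsTangent Q := golfStart_isTangent
    (Matrix.isHermitian_one.sub hQ) (by
      rw [Matrix.mul_sub, Matrix.sub_mul, mul_one, hQQ, hQQ, sub_self])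
  have hE1 : hs (1 - Q) (1 - Q) = r := by
    rw [hs, (Matrix.isHermitian_one.sub hQ).eq, ← htr]
    congr 2
    rw [Matrix.sub_mul, Matrix.mul_sub, Matrix.mul_sub, hQQ]; simp
  have hstb : ∀ b, (golfStart (tangentProj Q (w b))).IsTangent Q := fun b => golfStart_isTangent
      (tangentProj_isHermitian hQ (hw.isHermitian b)) (conj_tangentProj hQQ _)
  have hEb : ∀ b, (golfStart (tangentProj Q (w b))).energy ≤ 2 * d := fun b => by
    have := hs_tangentProj_self_le hQ hQQ (hw.isHermitian b) (hw.mul_self b)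
    rw [htr] at this
    exact this.trans (by linarith)
  -- the bounds for the two kinds of bad events: a residual stays large, or the compression of the
  -- certificate for `1 - Q` exceeds `1 / 2`
  have hexp1 : (2 * r * γ)⁻¹ * (30 * ℓ) - m * (4 * r * d)⁻¹ ≤ -(c * ℓ ^ 2 / 8) := by
    have e : (2 * r * γ)⁻¹ * (30 * ℓ) - m * (4 * r * d)⁻¹ = -(m / (8 * r * d)) := by
      rw [hγ]; field_simp; norm_num
    rw [e, neg_le_neg_iff, le_div_iff₀ (by positivity)]
    linarith
  have hbound : ∀ s : GolfState ι, s.IsTangent Q → s.energy ≤ 2 * d →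
      ((Finset.univ.filter fun A : Fin m → L => Real.exp (-(30 * ℓ)) * (2 * d) <
        ((List.ofFn A).foldl (golfStep w Q γ) s).energy).card : ℝ) ≤
      (d ^ 2) ^ m * Real.exp (-(c * ℓ ^ 2 / 8)) := fun s hs1 hs2 => by
    refine (h.card_energy_gt_le hs1 (by positivity) hs2 m (30 * ℓ)).trans ?_
    gcongr
  have hcert := h.card_certificate_le hst1 (θ := (4 * γ * r)⁻¹) (V := r) (by positivity) hE1.le
    (by field_simp; norm_num) m (1 / 2)
  have hexp2 : (4 * γ * r)⁻¹ ^ 2 * γ * r - (4 * γ * r)⁻¹ * (1 / 2) ≤ -(c * ℓ / 1920) := by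
    have e : (4 * γ * r)⁻¹ ^ 2 * γ * r - (4 * γ * r)⁻¹ * (1 / 2) = -(1 / (16 * (γ * r))) := by
      field_simp; norm_num
    rw [e, neg_le_neg_iff, le_div_iff₀ (by positivity)]
    linarith
  -- outside these events there is uniqueness
  have hsub : (Finset.univ.filter fun A : Fin m → L => ¬ ∀ Δ : Matrix ι ι ℂ, Δ.IsHermitian →
        (Q * Δ * Q).PosSemidef → Δ.trace = 0 → (∀ i, hs (w (A i)) Δ = 0) → Δ = 0) ⊆
      ((Finset.univ.biUnion fun b => Finset.univ.filter fun A : Fin m → L =>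
        Real.exp (-(30 * ℓ)) * (2 * d) < ((List.ofFn A).foldl (golfStep w Q γ)
          (golfStart (tangentProj Q (w b)))).energy) ∪
      (Finset.univ.filter fun A : Fin m → L => Real.exp (-(30 * ℓ)) * (2 * d) <
        ((List.ofFn A).foldl (golfStep w Q γ) (golfStart (1 - Q))).energy)) ∪
      (Finset.univ.filter fun A : Fin m → L => ¬ ((1 / 2 : ℝ) • (1 : Matrix ι ι ℂ) -
        Q * ((List.ofFn A).foldl (golfStep w Q γ) (golfStart (1 - Q))).certificate *
          Q).PosSemidef) := by
    intro A hA
    by_contra hgood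
    simp only [Finset.mem_union, Finset.mem_biUnion, Finset.mem_filter, Finset.mem_univ, true_and,
      not_or, not_exists, not_lt, not_not] at hgood hA
    obtain ⟨⟨hg1, hg2⟩, hg3⟩ := hgood
    apply hA
    intro Δ hΔ hΔQ hΔt hΔA
    have hdp : Real.exp (-(30 * ℓ)) = (d ^ 30)⁻¹ := by
      rw [Real.exp_neg, ← hexp, ← Real.exp_nat_mul]; norm_num
    have hp : ∀ k : ℕ, (2 : ℝ) ^ k ≤ d ^ k := fun k => pow_le_pow_left₀ (by norm_num) hd2 k
    refine h.eq_zero (δ := Real.exp (-(30 * ℓ)) * (2 * d)) (V := 2 * d) (l := List.ofFn A)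
      (by linarith) ?_ ?_ hg1 hg2 hg3 hΔ hΔQ hΔt ?_
    · rw [hdp, ← hd']
      have e : 4 * d * ((d ^ 30)⁻¹ * (2 * d)) = 8 / d ^ 28 := by field_simp; norm_num
      rw [e, div_le_one (by positivity)]
      exact le_trans (by norm_num) (hp 28)
    · rw [hdp, List.length_ofFn, ← hd']
      have e : 16 * d * (m * γ * d) ^ 2 * (2 * d) * ((d ^ 30)⁻¹ * (2 * d)) =
          921600 * ℓ ^ 2 / d ^ 23 := by
        rw [hγ]; field_simp; norm_num
      rw [e, div_lt_one (by positivity)]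
      have h1 : ℓ ^ 2 ≤ d ^ 2 := pow_le_pow_left₀ hℓ0.le hℓd 2
      have h2 : d ^ 23 = d ^ 21 * d ^ 2 := by ring
      have h3 : (921600 : ℝ) < d ^ 21 := lt_of_lt_of_le (by norm_num) (hp 21)
      rw [h2]
      nlinarith [mul_lt_mul_of_pos_right h3 (by positivity : 0 < d ^ 2)]
    · intro a ha
      obtain ⟨i, rfl⟩ := (List.mem_ofFn' _ _).1 ha
      exact hΔA i
  have hcard : (((Finset.univ : Finset L).card : ℕ) : ℝ) = d ^ 2 := by
    rw [Finset.card_univ, hw.card_eq, hd']; push_cast; rfl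
  have hN : 0 ≤ (d ^ 2) ^ m := by positivity
  calc _ ≤ _ := Nat.cast_le.2 ((Finset.card_le_card hsub).trans ((Finset.card_union_le _ _).trans
        (Nat.add_le_add_right ((Finset.card_union_le _ _).trans
          (Nat.add_le_add_right Finset.card_biUnion_le _)) _)))
    _ ≤ d ^ 2 * ((d ^ 2) ^ m * Real.exp (-(c * ℓ ^ 2 / 8))) +
          (d ^ 2) ^ m * Real.exp (-(c * ℓ ^ 2 / 8)) +
          (d ^ 2) ^ m * (d * Real.exp (-(c * ℓ / 1920))) := by
        push_cast
        refine add_le_add (add_le_add ?_ (hbound _ hst1 ?_)) (hcert.trans ?_)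
        · refine (Finset.sum_le_sum fun b _ => hbound _ (hstb b) (hEb b)).trans_eq ?_
          rw [Finset.sum_const, nsmul_eq_mul, hcard]
        · exact hE1.le.trans (by linarith)
        · gcongr
    _ = (d ^ 2) ^ m * ((d ^ 2 + 1) * Real.exp (-(c * ℓ ^ 2 / 8)) +
          d * Real.exp (-(c * ℓ / 1920))) := by ring
    _ ≤ _ := mul_le_mul_of_nonneg_left (failure_sum_le hexp hℓ1 hc) hN

end Count

/-! ### Pauli tomography -/

section Final

variable {n m : ℕ}

instance samplingLaw_isProbabilityMeasure : IsProbabilityMeasure (samplingLaw n m) := by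
  have : IsProbabilityMeasure (PMF.uniformOfFintype (PauliLabel n)).toMeasure :=
    PMF.toMeasure.isProbabilityMeasure _
  unfold samplingLaw
  infer_instance

lemma samplingLaw_real_eq (p : (Fin m → PauliLabel n) → Prop) [DecidablePred p] :
    (samplingLaw n m).real {A | p A} =
      (Finset.univ.filter p).card / (((2 : ℝ) ^ n) ^ 2) ^ m := by
  have hcard : Fintype.card (PauliLabel n) = (2 ^ n) ^ 2 := by
    simpa using (pauli_isUnitaryFrame (n := n)).card_eq
  have hsing : ∀ A : Fin m → PauliLabel n,
      (samplingLaw n m).real {A} = ((((2 : ℝ) ^ n) ^ 2) ^ m)⁻¹ := fun A => by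
    have : IsProbabilityMeasure (PMF.uniformOfFintype (PauliLabel n)).toMeasure :=
      PMF.toMeasure.isProbabilityMeasure _
    rw [Measure.real, samplingLaw, Measure.pi_singleton]
    simp only [PMF.toMeasure_apply_singleton _ _ (measurableSet_singleton _),
      PMF.uniformOfFintype_apply, hcard, Finset.prod_const, Finset.card_univ, Fintype.card_fin]
    simp
  have hset : {A | p A} = ((Finset.univ.filter p : Finset (Fin m → PauliLabel n)) : Set _) := by
    ext A; simp
  rw [hset, ← sum_measureReal_singleton]
  simp only [hsing, Finset.sum_const, nsmul_eq_mul]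
  rw [div_eq_mul_inv]

lemma IsDensityMatrix.solutions_eq {ρ : Operator n} (hρ : IsDensityMatrix ρ) {Q : Operator n}
    (hQ : Q.IsHermitian) (hQρ : Q * ρ * Q = 0) (A : Fin m → PauliLabel n)
    (h : ∀ Δ : Operator n, Δ.IsHermitian → (Q * Δ * Q).PosSemidef → Δ.trace = 0 →
      (∀ i, hs (pauli (A i)) Δ = 0) → Δ = 0) :
    solutions A (expectations A ρ) = {ρ} := by
  refine solutions_eq_singleton hρ A fun σ hσ hσt hσA => ?_
  refine sub_eq_zero.1 (h (σ - ρ) (hσ.isHermitian.sub hρ.posSemidef.isHermitian) ?_ ?_ fun i => ?_)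
  · rw [Matrix.mul_sub, Matrix.sub_mul, hQρ, sub_zero]
    have := hσ.mul_mul_conjTranspose_same Q
    rwa [hQ.eq] at this
  · rw [Matrix.trace_sub, hσt, hρ.trace_eq_one, sub_self]
  · have h1 := congrFun hσA i
    simp only [expectations] at h1
    rw [hs, (pauli_isHermitian (A i)).eq, Matrix.mul_sub, Matrix.trace_sub, h1, sub_self,
      Complex.zero_re]

/-- Without qubits, every matrix of trace one is the state. -/
lemma solutions_eq_of_zero_qubits {ρ : Operator 0} (hρ : IsDensityMatrix ρ)
    (A : Fin m → PauliLabel 0) : solutions A (expectations A ρ) = {ρ} := by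
  refine solutions_eq_singleton hρ A fun σ _ hσt _ => ?_
  have h := hσt.trans hρ.trace_eq_one.symm
  ext x y
  obtain rfl : y = x := Subsingleton.elim _ _
  rw [Matrix.trace, Matrix.trace, Fintype.sum_subsingleton _ y, Fintype.sum_subsingleton _ y] at h
  exact h

end Final
end PauliTomography

theorem theorem1 :
    ∃ C a : ℝ, 0 < C ∧ 0 < a ∧
      ∀ (n r m : ℕ) (ρ : PauliTomography.Operator n) (c : ℝ),
        PauliTomography.IsDensityMatrix ρ →
        ρ.rank = r →
        0 < c →
        c * (2 : ℝ) ^ n * (r : ℝ) * Real.log ((2 : ℝ) ^ n) ^ 2 ≤ (m : ℝ) →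
        (PauliTomography.samplingLaw n m).real
            {A | ¬ PauliTomography.solutions A (PauliTomography.expectations A ρ) = {ρ}}
          ≤ C * Real.exp (-(a * c)) := by
  classical
  refine ⟨4, 1 / 7680, by norm_num, by norm_num, fun n r m ρ c hρ hr hc hm => ?_⟩
  have hN : (0 : ℝ) < (((2 : ℝ) ^ n) ^ 2) ^ m := by positivity
  rcases Nat.eq_zero_or_pos n with rfl | hn
  · have h0 : {A : Fin m → PauliTomography.PauliLabel 0 | ¬ PauliTomography.solutions A
        (PauliTomography.expectations A ρ) = {ρ}} = ∅ := by
      ext A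
      simp [PauliTomography.solutions_eq_of_zero_qubits hρ A]
    rw [h0, MeasureTheory.measureReal_empty]
    positivity
  rcases le_total c 7680 with hc7 | hc7
  · -- any probability is at most `4 / e`
    refine MeasureTheory.measureReal_le_one.trans ?_
    have h2 : Real.exp (-1) ≤ Real.exp (-(1 / 7680 * c)) := Real.exp_le_exp.2 (by linarith)
    have h3 := Real.exp_neg_one_gt_d9
    linarith
  rw [PauliTomography.samplingLaw_real_eq, div_le_iff₀ hN]
  obtain ⟨Q, hQ, hQQ, hQρ, htr⟩ :=
    PauliTomography.exists_kernel_projection hρ.posSemidef.isHermitian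
  rw [hr] at htr
  have hr1 : 1 ≤ r := by
    rw [Nat.one_le_iff_ne_zero]
    rintro rfl
    have h0 : ρ = 0 := by
      have h1 := hρ.posSemidef.isHermitian.rank_eq_card_non_zero_eigs
      rw [hr, eq_comm, Fintype.card_eq_zero_iff, isEmpty_subtype] at h1
      exact hρ.posSemidef.isHermitian.eigenvalues_eq_zero_iff.1
        (funext fun i => not_not.1 (h1 i))
    have := hρ.trace_eq_one
    rw [h0] at this
    simp at this
  have hcard : Fintype.card (PauliTomography.Basis n) = 2 ^ n := by simp
  have hcard' : (Fintype.card (PauliTomography.Basis n) : ℝ) = 2 ^ n := by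
    rw [hcard]; push_cast; rfl
  have hmain := PauliTomography.card_not_unique_le PauliTomography.pauli_isUnitaryFrame hQ hQQ htr
    (by exact_mod_cast hr1) (by rw [hcard]; exact Nat.le_self_pow hn.ne' 2) hc7 (m := m)
    (by rw [hcard']; exact hm)
  rw [hcard'] at hmain
  rw [mul_comm, show -(1 / 7680 * c) = -(c / 7680) by ring]
  refine le_trans (Nat.cast_le.2 (Finset.card_le_card ?_)) hmain
  intro A hA
  rw [Finset.mem_filter] at hA ⊢
  exact ⟨hA.1, fun h => hA.2 (hρ.solutions_eq hQ hQρ A h)⟩
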